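/- **Theorem (consistency of grouped GEE).** *Data.* Fix a group size $L\ge 1$. For every number of groups $G$ let $y_i$ (real responses), $x_i$ (regressors in $\mathbb R^k$) and $\epsilon_i$ (innovations), defined on one probability space, be observed at distinct sites $i$ of a countably infinite lattice $D\subset\mathbb R^d$, $d\ge1$, that form $G$ groups $B_1,\dots,B_G$ of $L$ sites each (a triangular array in $G$; the index $G$ is suppressed). With $\rho$ the maximum metric, there is $\rho_0>0$ with $\rho(i,j)\ge\rho_0$ for all $i\ne j$ in $D$. Put $\varepsilon_i=(x_i,\epsilon_i)$, $\rho(g,h)=\min_{i\in B_g,j\in B_h}\rho(i,j)$, and write $x_g,y_g$ for the data of group $g$. *Model.* Let $\Theta\subset\mathbb R^p$, $\Gamma\subset\mathbb R^q$, $(\theta^0,\gamma^0)\in\Theta\times\Gamma$, let $\nu$ be a metric on $\Theta$, let $m_g(\theta)=m_g(x_g;\theta)\in\mathbb R^L$ with $E(y_g\mid x_g)=m_g(\theta^0)$, and let $W_g(\theta,\gamma)=W_g(x_g;\theta,\gamma)$ be invertible $L\times L$ matrices; $m_g$ and $W_g$ are measurable in $x_g$. Let $$q_g(\theta,\gamma)=(y_g-m_g(\theta))^\top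 W_g^{-1}(\theta,\gamma)(y_g-m_g(\theta)),\quad Q_G=\frac1{M_GG}\sum_{g}q_g,\quad \bar Q_G=\frac1{M_GG}\sum_{g}E\,q_g ,$$ let $s_g=\nabla m_g^\top W_g^{-1}(y_g-m_g)$, and let $h_g$ be the Jacobian matrix of $s_g$ in $\theta$. Here $M_G=\max_g(d_g\vee c_{g,q}\vee c_{g,s}\vee c_{g,h})$ with $d_g=\max_{i\in B_g}d_i$ and constants as follows. *Assumptions.* 1. (NED) $E|y_i|^4<\infty$ and $\|y_i-E(y_i\mid\sigma(\varepsilon_j:\rho(i,j)\le s))\|_4\le d_i\psi(s)$ for $s=0,1,2,\dots$, where $d_i>0$, $\sup d_i<\infty$, $\psi\ge 0$, $\psi(s)\to0$, $\sum_s s^{d-1}\psi(s)<\infty$. 2. (Mixing) For some $\tau\ge0$ the $\alpha$-mixing coefficients of $\varepsilon$ satisfy $\bar\alpha(u,v,r)\le(u+v)^\tau\hat\alpha(r)$ for integers $r\ge 1$, with $\hat\alpha(r)\to0$ and $\sum_r r^{d-1}\hat\alpha(r)<\infty$; likewise those of the grouped field (for sets of at most $u$ and $v$ groups at distance at least $r$)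 satisfy $\tilde\alpha(u,v,r)\le(u+v)^\tau L^\tau\hat\alpha'(r)$ with $\hat\alpha'(r)\to 0$ and $\sum_r L^\tau r^{d-1}\hat\alpha'(r)<\infty$. (The coefficients are suprema over all $G$ as well.) 3. (Compactness) $\Theta\times\Gamma$ is compact. 4. (Lipschitz) $|q_g(\theta,\gamma)-q_g(\theta',\gamma')|\le B_g(|\theta-\theta'|_2+|\gamma-\gamma'|_2)$ on $\Theta\times\Gamma$ with integrable $B_g\ge0$ and $\limsup_G (M_GG)^{-1}\sum_gE B_g<\infty$. 5. (Moments and scaling) For some $p''>1$ and $r>4p''$: the entries of $m_g$ and of $W_g^{-1}$ are three times continuously differentiable near $\Theta$, respectively $\Theta\times\Gamma$; $E|y_i|^r$, and the $r$-th moments of the suprema over the parameter space of these entries and of their derivatives up to order two, are bounded uniformly in $G,g$; the constants $c_{g,q},c_{g,s},c_{g,h}>0$ satisfy $\sup_{G,g}(c_{g,q}\vee c_{g,s}\vee c_{g,h})/d_g<\infty$, and for each $(\theta,\gamma)\in\Theta\times\Gamma$ the moments $E|q_g/c_{g,q}|^{p''}$, $E|s_g/c_{g,s}|_2^{p''}$,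 $E|h_g/c_{g,h}|_1^{p''}$ (with $|\cdot|_1$ the maximal absolute column sum) are bounded uniformly in $G,g$. 6. (Identification) For every $\varepsilon>0$ and every $\gamma\in\Gamma$, $$\liminf_{G\to\infty}\ \inf_{\theta\in\Theta:\ \nu(\theta,\theta^0)\ge\varepsilon}\Big[\bar Q_G(\theta,\gamma)-\min\{\bar Q_G(\theta^0,\gamma^0),\bar Q_G(\theta^0,\gamma)\}\Big]>0 .$$ *Conclusion.* If, for every $G$, almost surely $(\hat\theta,\hat\gamma)=(\hat\theta_G,\hat\gamma_G)$ minimises $Q_G$ over $\Theta\times\Gamma$, then $\nu(\hat\theta_G,\theta^0)\to0$ in probability as $G\to\infty$. -/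

import Mathlib

open MeasureTheory ProbabilityTheory Filter Topology
open scoped ENNReal NNReal Matrix

noncomputable section

namespace GEE

/-- Column `p`-vectors with the Euclidean norm. -/
abbrev Vec (p : ℕ) := EuclideanSpace ℝ (Fin p)

/-! ### Generic notions -/

/-- `ν` is a metric on the set `S`. -/
structure IsMetricOn {E : Type*} (ν : E → E → ℝ) (S : Set E) : Prop where
  nonneg : ∀ a ∈ S, ∀ b ∈ S, 0 ≤ ν a b
  eq_zero_iff : ∀ a ∈ S, ∀ b ∈ S, (ν a b = 0 ↔ a = b)
  symm : ∀ a ∈ S, ∀ b ∈ S, ν a b = ν b a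
  triangle : ∀ a ∈ S, ∀ b ∈ S, ∀ c ∈ S, ν a c ≤ ν a b + ν b c

/-- The `α`-mixing coefficient of two `σ`-algebras:
`sup |P(A ∩ B) - P(A) P(B)|` over `A ∈ 𝒜`, `B ∈ ℬ`. -/
def alphaCoeff {Ω : Type*} [MeasurableSpace Ω] (μ : Measure Ω)
    (𝒜 ℬ : MeasurableSpace Ω) : ℝ :=
  sSup {a : ℝ | ∃ A B : Set Ω, MeasurableSet[𝒜] A ∧ MeasurableSet[ℬ] B ∧
    a = |μ.real (A ∩ B) - μ.real A * μ.real B|}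

/-- The largest absolute column sum of a matrix. -/
def colSumNorm {p : ℕ} (A : Matrix (Fin p) (Fin p) ℝ) : ℝ :=
  ⨆ j, ∑ i, |A i j|

/-! ### Grouped spatial data -/

/-- A triangular array of spatial observations in groups of the fixed size `L`, indexed by the
number `G` of groups. The sites of the `G`-th array are indexed by pairs `(g, l)`: the `l`-th
member of group `g`. `site` is the location in `ℝ ^ d`, whose distance is the maximum metric;
`x` are the regressors, `innov` the innovations and `y` the responses. -/
structure Sample (Ω : Type*) [MeasurableSpace Ω] (𝓔 : Type*) [MeasurableSpace 𝓔]
    (d L k : ℕ) where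
  site : ∀ G : ℕ, Fin G × Fin L → (Fin d → ℝ)
  x : ∀ G : ℕ, Fin G × Fin L → Ω → (Fin k → ℝ)
  innov : ∀ G : ℕ, Fin G × Fin L → Ω → 𝓔
  y : ∀ G : ℕ, Fin G × Fin L → Ω → ℝ
  measurable_x : ∀ G i, Measurable (x G i)
  measurable_innov : ∀ G i, Measurable (innov G i)
  measurable_y : ∀ G i, Measurable (y G i)

namespace Sample

variable {Ω : Type*} [MeasurableSpace Ω] {𝓔 : Type*} [MeasurableSpace 𝓔] {d L k : ℕ}

/-- The input field: the pair of the regressor and the innovation at a site. -/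
def input (S : Sample Ω 𝓔 d L k) (G : ℕ) (i : Fin G × Fin L) (ω : Ω) : (Fin k → ℝ) × 𝓔 :=
  (S.x G i ω, S.innov G i ω)

/-- The `σ`-algebra generated by the input field on a set of sites. -/
abbrev sigma (S : Sample Ω 𝓔 d L k) (G : ℕ) (U : Set (Fin G × Fin L)) : MeasurableSpace Ω :=
  ⨆ i ∈ U, MeasurableSpace.comap (S.input G i) inferInstance

/-- The `σ`-algebra generated by the input field within distance `s` of the site `i`. -/
abbrev nearSigma (S : Sample Ω 𝓔 d L k) (G : ℕ) (i : Fin G × Fin L) (s : ℕ) : MeasurableSpace Ω :=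
  S.sigma G {j | dist (S.site G i) (S.site G j) ≤ s}

/-- The sites lie, pairwise distinct, in an infinite countable lattice of `ℝ ^ d`, `1 ≤ d`, with
a positive minimum distance. -/
def OnLattice (S : Sample Ω 𝓔 d L k) : Prop :=
  1 ≤ d ∧ ∃ D : Set (Fin d → ℝ), D.Countable ∧ D.Infinite ∧
    (∃ ρ₀ : ℝ, 0 < ρ₀ ∧ ∀ a ∈ D, ∀ b ∈ D, a ≠ b → ρ₀ ≤ dist a b) ∧
    ∀ G, Function.Injective (S.site G) ∧ ∀ i, S.site G i ∈ D

/-- The mixing coefficient of the input field: the supremum of the `α`-mixing coefficients over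
all arrays and all sets of at most `u` and at most `v` sites at distance at least `r`. -/
def mixing (S : Sample Ω 𝓔 d L k) (μ : Measure Ω) (u v r : ℕ) : ℝ :=
  sSup {a : ℝ | ∃ (G : ℕ) (U V : Finset (Fin G × Fin L)), U.card ≤ u ∧ V.card ≤ v ∧
    (∀ i ∈ U, ∀ j ∈ V, (r : ℝ) ≤ dist (S.site G i) (S.site G j)) ∧
    a = alphaCoeff μ (S.sigma G U) (S.sigma G V)}

/-- The distance of two groups: the smallest distance of their members. -/
def groupDist (S : Sample Ω 𝓔 d L k) (G : ℕ) (g h : Fin G) : ℝ :=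
  ⨅ l : Fin L × Fin L, dist (S.site G (g, l.1)) (S.site G (h, l.2))

/-- The mixing coefficient of the grouped input field: as above, for sets of at most `u` and at
most `v` groups at group distance at least `r`. -/
def groupMixing (S : Sample Ω 𝓔 d L k) (μ : Measure Ω) (u v r : ℕ) : ℝ :=
  sSup {a : ℝ | ∃ (G : ℕ) (U V : Finset (Fin G)), U.card ≤ u ∧ V.card ≤ v ∧
    (∀ g ∈ U, ∀ h ∈ V, (r : ℝ) ≤ S.groupDist G g h) ∧
    a = alphaCoeff μ (S.sigma G {i | i.1 ∈ U}) (S.sigma G {i | i.1 ∈ V})}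

/-- `α`-mixing of the input field with `∑ r ^ (d - 1) α̂(r) < ∞`. -/
def IsMixing (S : Sample Ω 𝓔 d L k) (μ : Measure Ω) (τ : ℝ) : Prop :=
  ∃ αhat : ℕ → ℝ,
    (∀ u v r : ℕ, 1 ≤ r → S.mixing μ u v r ≤ ((u : ℝ) + v) ^ τ * αhat r) ∧
    Tendsto αhat atTop (𝓝 0) ∧ Summable fun r : ℕ => (r : ℝ) ^ (d - 1) * αhat r

/-- `α`-mixing of the grouped input field with `∑ L ^ τ r ^ (d - 1) α̂(r) < ∞`. -/
def IsGroupMixing (S : Sample Ω 𝓔 d L k) (μ : Measure Ω) (τ : ℝ) : Prop :=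
  ∃ αhat : ℕ → ℝ,
    (∀ u v r : ℕ, 1 ≤ r →
      S.groupMixing μ u v r ≤ ((u : ℝ) + v) ^ τ * (L : ℝ) ^ τ * αhat r) ∧
    Tendsto αhat atTop (𝓝 0) ∧
    Summable fun r : ℕ => (L : ℝ) ^ τ * (r : ℝ) ^ (d - 1) * αhat r

/-- The responses are uniformly `L_a`-near-epoch dependent on the input field, with scaling
factors `δ` and coefficients `ψ`. -/
structure IsUniformlyNED (S : Sample Ω 𝓔 d L k) (μ : Measure Ω) (a : ℝ≥0∞)
    (δ : ∀ G : ℕ, Fin G × Fin L → ℝ) (ψ : ℕ → ℝ) : Prop where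
  memLp : ∀ G i, MemLp (S.y G i) a μ
  scale_pos : ∀ G i, 0 < δ G i
  scale_bdd : ∃ C : ℝ, ∀ G i, δ G i ≤ C
  coeff_nonneg : ∀ s, 0 ≤ ψ s
  coeff_tendsto : Tendsto ψ atTop (𝓝 0)
  near : ∀ G i s, eLpNorm (S.y G i - μ[S.y G i | S.nearSigma G i s]) a μ
    ≤ ENNReal.ofReal (δ G i * ψ s)

/-- The regressors of group `g`. -/
def xg (S : Sample Ω 𝓔 d L k) (G : ℕ) (g : Fin G) (ω : Ω) : Fin L → Fin k → ℝ :=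
  fun l => S.x G (g, l) ω

/-- The responses of group `g`. -/
def yg (S : Sample Ω 𝓔 d L k) (G : ℕ) (g : Fin G) (ω : Ω) : Fin L → ℝ :=
  fun l => S.y G (g, l) ω

end Sample

/-! ### Mean and weight specification, criterion, score and Hessian -/

/-- A parametric specification of the conditional mean vector `m_g(x_g; θ)` and of the working
covariance matrix `W_g(x_g; θ, γ)` of every group, both measurable in the regressors. -/
structure Spec (L k p q : ℕ) where
  m : ∀ G : ℕ, Fin G → (Fin L → Fin k → ℝ) → Vec p → Fin L → ℝ
  W : ∀ G : ℕ, Fin G → (Fin L → Fin k → ℝ) → Vec p → Vec q → Matrix (Fin L) (Fin L) ℝ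
  measurable_m : ∀ G g θ l, Measurable fun x => m G g x θ l
  measurable_W : ∀ G g θ γ i j, Measurable fun x => W G g x θ γ i j

/-- The data of the estimation problem: a sample and a specification. -/
structure Problem (Ω : Type*) [MeasurableSpace Ω] (𝓔 : Type*) [MeasurableSpace 𝓔]
    (d L k p q : ℕ) extends Sample Ω 𝓔 d L k, Spec L k p q

/-- The arrays of positive constants that scale the criterion: the scaling factors `δ` of
near-epoch dependence, and constants dominating the moments of the group criterion, score and
Hessian. -/
structure Scaling (L : ℕ) where
  δ : ∀ G : ℕ, Fin G × Fin L → ℝ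
  cq : ∀ G : ℕ, Fin G → ℝ
  cs : ∀ G : ℕ, Fin G → ℝ
  ch : ∀ G : ℕ, Fin G → ℝ

namespace Scaling

variable {L : ℕ}

/-- `d_g`, the largest scaling factor in group `g`. -/
def dg (c : Scaling L) (G : ℕ) (g : Fin G) : ℝ := ⨆ l : Fin L, c.δ G (g, l)

/-- `c_{g,q} ∨ c_{g,s} ∨ c_{g,h}`. -/
def cmax (c : Scaling L) (G : ℕ) (g : Fin G) : ℝ := max (max (c.cq G g) (c.cs G g)) (c.ch G g)

/-- `M_G`, the largest of all `d_g`, `c_{g,q}`, `c_{g,s}`, `c_{g,h}`. -/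
def M (c : Scaling L) (G : ℕ) : ℝ := ⨆ g : Fin G, max (c.dg G g) (c.cmax G g)

/-- Positivity, and `(c_{g,q} ∨ c_{g,s} ∨ c_{g,h}) / d_g` bounded uniformly. -/
structure IsAdmissible (c : Scaling L) : Prop where
  cq_pos : ∀ G g, 0 < c.cq G g
  cs_pos : ∀ G g, 0 < c.cs G g
  ch_pos : ∀ G g, 0 < c.ch G g
  ratio_bdd : ∃ C₅ : ℝ, ∀ G g, c.cmax G g / c.dg G g ≤ C₅

end Scaling

namespace Problem

variable {Ω : Type*} [MeasurableSpace Ω] {𝓔 : Type*} [MeasurableSpace 𝓔] {d L k p q : ℕ}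

/-- The `l`-th entry of the mean vector of group `g` at the observed regressors. -/
def mean (P : Problem Ω 𝓔 d L k p q) (G : ℕ) (g : Fin G) (ω : Ω) (θ : Vec p) (l : Fin L) : ℝ :=
  P.m G g (P.xg G g ω) θ l

/-- The weight matrix `W_g(θ, γ)` at the observed regressors. -/
def weight (P : Problem Ω 𝓔 d L k p q) (G : ℕ) (g : Fin G) (ω : Ω) (θ : Vec p) (γ : Vec q) :
    Matrix (Fin L) (Fin L) ℝ :=
  P.W G g (P.xg G g ω) θ γ

/-- The residual vector `y_g - m_g(θ)`. -/
def resid (P : Problem Ω 𝓔 d L k p q) (G : ℕ) (g : Fin G) (ω : Ω) (θ : Vec p) : Fin L → ℝ :=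
  fun l => P.yg G g ω l - P.mean G g ω θ l

/-- The group criterion `q_g(θ, γ) = (y_g - m_g(θ))ᵀ W_g⁻¹(θ, γ) (y_g - m_g(θ))`. -/
def crit (P : Problem Ω 𝓔 d L k p q) (G : ℕ) (g : Fin G) (ω : Ω) (θ : Vec p) (γ : Vec q) : ℝ :=
  P.resid G g ω θ ⬝ᵥ ((P.weight G g ω θ γ)⁻¹ *ᵥ P.resid G g ω θ)

/-- The `L × p` matrix `∇ m_g(θ)`. -/
def gradMean (P : Problem Ω 𝓔 d L k p q) (G : ℕ) (g : Fin G) (ω : Ω) (θ : Vec p) :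
    Matrix (Fin L) (Fin p) ℝ :=
  Matrix.of fun l a => fderiv ℝ (fun t => P.mean G g ω t l) θ (EuclideanSpace.single a 1)

/-- The group quasi-score `s_g(θ, γ) = ∇ m_g(θ)ᵀ W_g⁻¹(θ, γ) (y_g - m_g(θ))`. -/
def score (P : Problem Ω 𝓔 d L k p q) (G : ℕ) (g : Fin G) (ω : Ω) (θ : Vec p) (γ : Vec q) :
    Vec p :=
  WithLp.toLp 2 ((P.gradMean G g ω θ)ᵀ *ᵥ ((P.weight G g ω θ γ)⁻¹ *ᵥ P.resid G g ω θ))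

/-- The group Hessian `h_g(θ, γ)`, the `p × p` Jacobian matrix of the quasi-score in `θ`. -/
def hess (P : Problem Ω 𝓔 d L k p q) (G : ℕ) (g : Fin G) (ω : Ω) (θ : Vec p) (γ : Vec q) :
    Matrix (Fin p) (Fin p) ℝ :=
  Matrix.of fun a b =>
    fderiv ℝ (fun t => P.score G g ω t γ a) θ (EuclideanSpace.single b 1)

/-- The criterion `Q_G(θ, γ) = (M_G G)⁻¹ ∑_g q_g(θ, γ)`. -/
def Q (P : Problem Ω 𝓔 d L k p q) (c : Scaling L) (G : ℕ) (ω : Ω) (θ : Vec p) (γ : Vec q) : ℝ :=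
  (c.M G * G)⁻¹ * ∑ g, P.crit G g ω θ γ

/-- The expected criterion `(M_G G)⁻¹ ∑_g E q_g(θ, γ)`. -/
def Qbar (P : Problem Ω 𝓔 d L k p q) (c : Scaling L) (μ : Measure Ω) (G : ℕ)
    (θ : Vec p) (γ : Vec q) : ℝ :=
  (c.M G * G)⁻¹ * ∑ g, ∫ ω, P.crit G g ω θ γ ∂μ

/-- The conditional mean is correctly specified: `E(y_g | x_g) = m_g(x_g; θ⁰)`. -/
def CorrectMean (P : Problem Ω 𝓔 d L k p q) (μ : Measure Ω) (θ₀ : Vec p) : Prop :=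
  ∀ (G : ℕ) (g : Fin G) (l : Fin L),
    μ[P.y G (g, l) | MeasurableSpace.comap (P.xg G g) inferInstance]
      =ᵐ[μ] fun ω => P.mean G g ω θ₀ l

/-- The group criteria are Lipschitz continuous in the parameter, with random Lipschitz constants
whose normalised average expectation `(M_G G)⁻¹ ∑_g E B_g` stays bounded. -/
def IsLipschitz (P : Problem Ω 𝓔 d L k p q) (c : Scaling L) (μ : Measure Ω)
    (Θ : Set (Vec p)) (Γ : Set (Vec q)) : Prop :=
  ∃ B : ∀ G : ℕ, Fin G → Ω → ℝ,
    (∀ G g, Integrable (B G g) μ) ∧ (∀ G g ω, 0 ≤ B G g ω) ∧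
    (∀ G g ω, ∀ θ ∈ Θ, ∀ γ ∈ Γ, ∀ θ' ∈ Θ, ∀ γ' ∈ Γ,
      |P.crit G g ω θ γ - P.crit G g ω θ' γ'| ≤ B G g ω * (‖θ - θ'‖ + ‖γ - γ'‖)) ∧
    ∃ K : ℝ, ∀ᶠ G : ℕ in atTop, (c.M G * G)⁻¹ * ∑ g, ∫ ω, B G g ω ∂μ ≤ K

/-- Smoothness of the entries of `m_g` and `W_g⁻¹`, and bounds, uniform over groups and arrays,
of `r`-th moments of the responses and of suprema over the parameter space of the entries of
`m_g` and `W_g⁻¹` and of their derivatives up to the second order (`n = 0` is the entry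
itself). -/
structure HasMoments (P : Problem Ω 𝓔 d L k p q) (μ : Measure Ω)
    (Θ : Set (Vec p)) (Γ : Set (Vec q)) (r : ℝ) : Prop where
  invertible : ∀ G g ω, ∀ θ ∈ Θ, ∀ γ ∈ Γ, IsUnit (P.weight G g ω θ γ)
  smooth_m : ∀ G g ω l, ∀ θ ∈ Θ, ContDiffAt ℝ 3 (fun t => P.mean G g ω t l) θ
  smooth_w : ∀ G g ω i j, ∀ z ∈ Θ ×ˢ Γ,
    ContDiffAt ℝ 3 (fun z : Vec p × Vec q => (P.weight G g ω z.1 z.2)⁻¹ i j) z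
  moment_y : ∃ C : ℝ≥0, ∀ G i, ∫⁻ ω, ‖P.y G i ω‖ₑ ^ r ∂μ ≤ C
  moment_m : ∃ C : ℝ≥0, ∀ n ≤ 2, ∀ G g l,
    ∫⁻ ω, (⨆ θ ∈ Θ, ‖iteratedFDeriv ℝ n (fun t => P.mean G g ω t l) θ‖ₑ) ^ r ∂μ ≤ C
  moment_w : ∃ C : ℝ≥0, ∀ n ≤ 2, ∀ G g i j,
    ∫⁻ ω, (⨆ z ∈ Θ ×ˢ Γ, ‖iteratedFDeriv ℝ n
      (fun z : Vec p × Vec q => (P.weight G g ω z.1 z.2)⁻¹ i j) z‖ₑ) ^ r ∂μ ≤ C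

/-- At every parameter value, the `a`-th moments of `q_g / c_{g,q}`, `|s_g / c_{g,s}|_2` and
`|h_g / c_{g,h}|_1` are bounded uniformly over groups and arrays. -/
def IsDominated (P : Problem Ω 𝓔 d L k p q) (c : Scaling L) (μ : Measure Ω)
    (Θ : Set (Vec p)) (Γ : Set (Vec q)) (a : ℝ) : Prop :=
  ∀ θ ∈ Θ, ∀ γ ∈ Γ, ∃ C : ℝ≥0, ∀ G g,
    ∫⁻ ω, ‖P.crit G g ω θ γ / c.cq G g‖ₑ ^ a ∂μ ≤ C ∧
    ∫⁻ ω, ‖(c.cs G g)⁻¹ • P.score G g ω θ γ‖ₑ ^ a ∂μ ≤ C ∧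
    ∫⁻ ω, ‖colSumNorm ((c.ch G g)⁻¹ • P.hess G g ω θ γ)‖ₑ ^ a ∂μ ≤ C

/-- Identification of `(θ⁰, γ⁰)`: for every `ε > 0` and every `γ`, the limit inferior in `G` of
the infimum over `θ` with `ν(θ, θ⁰) ≥ ε` of
`Q̄_G(θ, γ) - min (Q̄_G(θ⁰, γ⁰)) (Q̄_G(θ⁰, γ))` is positive. -/
def IsIdentified (P : Problem Ω 𝓔 d L k p q) (c : Scaling L) (μ : Measure Ω)
    (Θ : Set (Vec p)) (Γ : Set (Vec q)) (ν : Vec p → Vec p → ℝ)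
    (θ₀ : Vec p) (γ₀ : Vec q) : Prop :=
  ∀ ε > 0, ∀ γ ∈ Γ, ∃ c₀ > 0, ∀ᶠ G : ℕ in atTop, ∀ θ ∈ Θ, ε ≤ ν θ θ₀ →
    c₀ ≤ P.Qbar c μ G θ γ - min (P.Qbar c μ G θ₀ γ₀) (P.Qbar c μ G θ₀ γ)

/-- `(θ, γ)` minimises the criterion over `Θ × Γ` for the outcome `ω`. -/
def IsGEE (P : Problem Ω 𝓔 d L k p q) (c : Scaling L) (Θ : Set (Vec p)) (Γ : Set (Vec q))
    (G : ℕ) (ω : Ω) (θ : Vec p) (γ : Vec q) : Prop :=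
  θ ∈ Θ ∧ γ ∈ Γ ∧ ∀ θ' ∈ Θ, ∀ γ' ∈ Γ, P.Q c G ω θ γ ≤ P.Q c G ω θ' γ'

end Problem

end GEE

end

/-! ### A covariance inequality for `α`-mixing `σ`-algebras -/

/-! This is the extremum-estimator argument: a uniform law of large numbers in `L¹` for the
criterion, combined with identification. The pointwise law (`tendsto_integral_abs_Q_sub_Qbar`)
compares `q_g / M_G` with a bounded local statistic. The responses are replaced by their conditional
expectations given the inputs within distance `s`, and the resulting quadratic form is truncated at
`K`. Hölder's inequality with three `L⁴` factors makes the first error of order `ψ s`, and the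
moment of order `a > 1` makes the truncation error of order `K ^ (1 - a)`, both uniformly in the
group. The local statistics of two distant groups are functions of the inputs on two distant sets of
sites of bounded size, so mixing makes their covariance small (`abs_covariance_le_alphaCoeff`).
Since the lattice puts only boundedly many groups near a given one, the variance of the average
tends to zero (`integral_sq_average_le`). Compactness and the Lipschitz condition pass from finitely
many parameter values to all of them (`IsLipschitz.eventually_exists_dominating`). Identification
fixes `γ`, whereas `γhat` is random; `tendstoInMeasure_of_isGEE` therefore covers `Γ` by finitely
many balls, on each of which moving `γ` costs only a fraction of the identification gap. If `θhat`
is far from `θ₀`, the uniform error must exceed a fixed constant, and Markov's inequality ends the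
proof. -/

lemma abs_integral_mul_le_of_abs_setIntegral_le {Ω : Type*} {m₀ : MeasurableSpace Ω}
    {μ : Measure Ω} [IsFiniteMeasure μ] {ℬ : MeasurableSpace Ω} (hℬ : ℬ ≤ m₀)
    {φ g : Ω → ℝ} {α K : ℝ} (hφ : Integrable φ μ) (hg : Measurable[ℬ] g) (hK : 0 ≤ K)
    (hgK : ∀ ω, |g ω| ≤ K) (hα : ∀ B, MeasurableSet[ℬ] B → |∫ ω in B, φ ω ∂μ| ≤ α) :
    |∫ ω, g ω * φ ω ∂μ| ≤ 2 * K * α := by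
  have hgs : StronglyMeasurable[ℬ] g := hg.stronglyMeasurable
  have hgφ : Integrable (g * φ) μ :=
    hφ.bdd_mul (hgs.mono hℬ).aestronglyMeasurable (ae_of_all _ hgK)
  -- As `g` is `ℬ`-measurable, only the projection of `φ` on `ℬ` matters. Its `L¹` norm is the sum
  -- of two integrals of `φ`, up to sign, over the sets of `ℬ` where the projection is nonnegative
  -- and negative; hence the factor 2.
  have h1 : ∫ ω, g ω * φ ω ∂μ = ∫ ω, g ω * (μ[φ|ℬ]) ω ∂μ := by
    have h := condExp_mul_of_stronglyMeasurable_left hgs hgφ hφ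
    calc ∫ ω, g ω * φ ω ∂μ = ∫ ω, (μ[g * φ|ℬ]) ω ∂μ := (integral_condExp hℬ).symm
      _ = _ := integral_congr_ae h
  have hψ : Integrable (μ[φ|ℬ]) μ := integrable_condExp
  set B : Set Ω := {ω | 0 ≤ (μ[φ|ℬ]) ω} with hB
  have hBm : MeasurableSet[ℬ] B :=
    stronglyMeasurable_condExp.measurable measurableSet_Ici
  have hpos : ∫ ω in B, |(μ[φ|ℬ]) ω| ∂μ = ∫ ω in B, φ ω ∂μ := by
    rw [← setIntegral_condExp hℬ hφ hBm]
    exact setIntegral_congr_fun (hℬ _ hBm) fun ω hω => abs_of_nonneg hω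
  have hneg : ∫ ω in Bᶜ, |(μ[φ|ℬ]) ω| ∂μ = -∫ ω in Bᶜ, φ ω ∂μ := by
    rw [← setIntegral_condExp hℬ hφ hBm.compl, ← integral_neg]
    exact setIntegral_congr_fun (hℬ _ hBm.compl) fun ω hω =>
      abs_of_neg (not_le.1 hω)
  have hsum : ∫ ω, |(μ[φ|ℬ]) ω| ∂μ ≤ 2 * α := by
    rw [← integral_add_compl (hℬ _ hBm) hψ.abs, hpos, hneg]
    have := abs_le.1 (hα _ hBm)
    have := abs_le.1 (hα _ hBm.compl)
    linarith
  calc |∫ ω, g ω * φ ω ∂μ| ≤ ∫ ω, |g ω * (μ[φ|ℬ]) ω| ∂μ := by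
        rw [h1]; exact abs_integral_le_integral_abs
    _ ≤ ∫ ω, K * |(μ[φ|ℬ]) ω| ∂μ := by
        refine integral_mono_of_nonneg (ae_of_all _ fun _ => abs_nonneg _) (hψ.abs.const_mul K)
          (ae_of_all _ fun ω => ?_)
        simp only [abs_mul]
        exact mul_le_mul_of_nonneg_right (hgK ω) (abs_nonneg _)
    _ = K * ∫ ω, |(μ[φ|ℬ]) ω| ∂μ := integral_const_mul _ _
    _ ≤ K * (2 * α) := mul_le_mul_of_nonneg_left hsum hK
    _ = 2 * K * α := by ring

lemma abs_real_inter_sub_mul_le_one {Ω : Type*} {m₀ : MeasurableSpace Ω} (μ : Measure Ω)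
    [IsProbabilityMeasure μ] (A B : Set Ω) :
    |μ.real (A ∩ B) - μ.real A * μ.real B| ≤ 1 := by
  have h1 := measureReal_nonneg (μ := μ) (s := A ∩ B)
  have h2 := measureReal_le_one (μ := μ) (s := A ∩ B)
  have h3 := measureReal_nonneg (μ := μ) (s := A)
  have h4 := measureReal_le_one (μ := μ) (s := A)
  have h5 := measureReal_nonneg (μ := μ) (s := B)
  have h6 := measureReal_le_one (μ := μ) (s := B)
  have h7 := mul_nonneg h3 h5
  have h8 := mul_le_one₀ h4 h5 h6
  exact abs_le.2 ⟨by linarith, by linarith⟩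

namespace GEE

lemma le_alphaCoeff {Ω : Type*} {m₀ : MeasurableSpace Ω} (μ : Measure Ω)
    [IsProbabilityMeasure μ] {𝒜 ℬ : MeasurableSpace Ω} {A B : Set Ω} (hA : MeasurableSet[𝒜] A)
    (hB : MeasurableSet[ℬ] B) :
    |μ.real (A ∩ B) - μ.real A * μ.real B| ≤ @alphaCoeff Ω m₀ μ 𝒜 ℬ :=
  le_csSup ⟨1, by rintro _ ⟨A, B, -, -, rfl⟩; exact abs_real_inter_sub_mul_le_one μ A B⟩
    ⟨A, B, hA, hB, rfl⟩

lemma alphaCoeff_le_one {Ω : Type*} {m₀ : MeasurableSpace Ω} (μ : Measure Ω)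
    [IsProbabilityMeasure μ] (𝒜 ℬ : MeasurableSpace Ω) : @alphaCoeff Ω m₀ μ 𝒜 ℬ ≤ 1 :=
  csSup_le ⟨_, ∅, ∅, @MeasurableSet.empty _ 𝒜, @MeasurableSet.empty _ ℬ, rfl⟩
    (by rintro _ ⟨A, B, -, -, rfl⟩; exact abs_real_inter_sub_mul_le_one μ A B)

/-- The covariance of bounded functions is controlled by the `α`-mixing coefficient of the
`σ`-algebras with respect to which they are measurable. -/
theorem abs_covariance_le_alphaCoeff {Ω : Type*} {m₀ : MeasurableSpace Ω} (μ : Measure Ω)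
    [IsProbabilityMeasure μ] {𝒜 ℬ : MeasurableSpace Ω} (h𝒜 : 𝒜 ≤ m₀) (hℬ : ℬ ≤ m₀)
    {f g : Ω → ℝ} {K : ℝ} (hf : Measurable[𝒜] f) (hg : Measurable[ℬ] g) (hK : 0 ≤ K)
    (hfK : ∀ ω, |f ω| ≤ K) (hgK : ∀ ω, |g ω| ≤ K) :
    |∫ ω, (f ω - ∫ x, f x ∂μ) * (g ω - ∫ x, g x ∂μ) ∂μ| ≤ 4 * K ^ 2 * @alphaCoeff Ω m₀ μ 𝒜 ℬ := by
  have hgi : Integrable g μ :=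
    Integrable.of_bound (hg.mono hℬ le_rfl).aestronglyMeasurable K (ae_of_all _ hgK)
  -- The one-sided bound is applied twice. Here `φ` is the centred indicator of `A`, whose integrals
  -- over sets of `ℬ` are exactly the differences measured by `α`. Below, `φ` is the centred `g`,
  -- with the roles of `𝒜` and `ℬ` exchanged. The constants multiply to `(2 * K) ^ 2`.
  have hind : ∀ A, MeasurableSet[𝒜] A →
      |∫ ω in A, (g ω - ∫ x, g x ∂μ) ∂μ| ≤ 2 * K * @alphaCoeff Ω m₀ μ 𝒜 ℬ := by
    intro A hA
    have hAi : Integrable (fun ω => A.indicator (fun _ => (1 : ℝ)) ω - μ.real A) μ :=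
      ((integrable_const 1).indicator (h𝒜 _ hA)).sub (integrable_const _)
    have key := abs_integral_mul_le_of_abs_setIntegral_le (α := @alphaCoeff Ω m₀ μ 𝒜 ℬ)
      hℬ hAi hg hK hgK
      (fun B hB => by
        rw [integral_sub ((integrable_const 1).indicator (h𝒜 _ hA)) (integrable_const _),
          setIntegral_indicator (h𝒜 _ hA)]
        simp only [integral_const, measureReal_restrict_apply_univ, smul_eq_mul, mul_one]
        rw [Set.inter_comm, mul_comm]
        exact le_alphaCoeff μ hA hB)
    convert key using 2
    have e1 : ∀ ω, g ω * (A.indicator (fun _ => (1 : ℝ)) ω - μ.real A)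
        = A.indicator g ω - g ω * μ.real A := by
      intro ω
      by_cases h : ω ∈ A <;> simp [h, mul_sub]
    simp_rw [e1]
    rw [integral_sub (hgi.indicator (h𝒜 _ hA)) (hgi.mul_const _), integral_indicator (h𝒜 _ hA),
      integral_mul_const, integral_sub hgi.integrableOn (integrable_const _)]
    simp [mul_comm]
  have hg0 : Integrable (fun ω => g ω - ∫ x, g x ∂μ) μ := hgi.sub (integrable_const _)
  have key := abs_integral_mul_le_of_abs_setIntegral_le h𝒜 hg0 hf hK hfK hind
  -- Centring `f` is redundant once `g` is centred.
  have e : ∫ ω, (f ω - ∫ x, f x ∂μ) * (g ω - ∫ x, g x ∂μ) ∂μ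
      = ∫ ω, f ω * (g ω - ∫ x, g x ∂μ) ∂μ := by
    simp_rw [sub_mul]
    rw [integral_sub (hg0.bdd_mul (hf.mono h𝒜 le_rfl).aestronglyMeasurable (ae_of_all _ hfK))
      (hg0.const_mul _), integral_const_mul, integral_sub hgi (integrable_const _)]
    simp
  rw [e]
  refine key.trans (le_of_eq (by ring))

end GEE

/-! ### Truncation -/

/-- Truncation of a real number to the interval `[-K, K]`. -/
noncomputable def truncateAt (K x : ℝ) : ℝ := max (min x K) (-K)

lemma abs_truncateAt_le {K : ℝ} (hK : 0 ≤ K) (x : ℝ) : |truncateAt K x| ≤ K :=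
  abs_le.2 ⟨le_max_right _ _, max_le (min_le_right _ _) (by linarith)⟩

lemma abs_truncateAt_sub_truncateAt_le (K x y : ℝ) :
    |truncateAt K x - truncateAt K y| ≤ |x - y| :=
  (abs_max_sub_max_le_abs _ _ _).trans <| by
    simpa using abs_min_sub_min_le_max x K y K

lemma measurable_truncateAt (K : ℝ) : Measurable (truncateAt K) :=
  (measurable_id.min measurable_const).max measurable_const

/-- There is no error when `|x| ≤ K`; beyond `K` the error is at most `|x| = |x| ^ (1 - a) * |x| ^
a`, and `1 - a` is not positive. -/
lemma abs_sub_truncateAt_le {K a : ℝ} (hK : 0 < K) (ha : 1 ≤ a) (x : ℝ) :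
    |x - truncateAt K x| ≤ K ^ (1 - a) * |x| ^ a := by
  rcases le_or_gt |x| K with h | h
  · have h' := abs_le.1 h
    have : truncateAt K x = x := by
      rw [truncateAt, min_eq_left h'.2, max_eq_left h'.1]
    rw [this, sub_self, abs_zero]
    positivity
  · have h0 : 0 < |x| := hK.trans h
    have h1 : |x - truncateAt K x| ≤ |x| := by
      simp only [truncateAt]
      rcases lt_abs.1 h with h2 | h2
      · rw [min_eq_right h2.le, max_eq_left (by linarith), abs_of_pos (by linarith : 0 < x),
          abs_of_nonneg (by linarith)]
        linarith
      · rw [min_eq_left (by linarith), max_eq_right (by linarith), abs_of_neg (by linarith : x < 0),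
          abs_of_nonpos (by linarith)]
        linarith
    calc |x - truncateAt K x| ≤ |x| := h1
      _ = |x| ^ (1 - a) * |x| ^ a := by
        rw [← Real.rpow_add h0]; simp
      _ ≤ K ^ (1 - a) * |x| ^ a := by
        refine mul_le_mul_of_nonneg_right ?_ (by positivity)
        exact Real.rpow_le_rpow_of_nonpos hK h.le (by linarith)

/-! ### Packing -/

/-- In a proper normed group, a ball of fixed radius contains boundedly many points of a family
with positive minimum distance. -/
lemma exists_card_le_of_separated {E : Type*} [NormedAddCommGroup E] [ProperSpace E] {ρ : ℝ}
    (hρ : 0 < ρ) (R : ℝ) :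
    ∃ N : ℕ, ∀ {ι : Type} (s : ι → E), (∀ i j, i ≠ j → ρ ≤ dist (s i) (s j)) →
      ∀ (c : E) (F : Finset ι), (∀ i ∈ F, dist c (s i) ≤ R) → F.card ≤ N := by
  -- After translation to the origin, a cover by balls of radius `ρ / 2` serves every centre at
  -- once, and each of these balls holds at most one point of the family.
  obtain ⟨t, ht, hcov⟩ := Metric.totallyBounded_iff.1
    (isCompact_closedBall (0 : E) R).totallyBounded (ρ / 2) (by positivity)
  refine ⟨ht.toFinset.card, fun s hs c F hF => ?_⟩
  have hex : ∀ i ∈ F, ∃ y ∈ t, dist (s i - c) y < ρ / 2 := fun i hi => by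
    have : s i - c ∈ Metric.closedBall (0 : E) R := by
      rw [mem_closedBall_zero_iff, ← dist_eq_norm, dist_comm]
      exact hF i hi
    simpa using hcov this
  choose! y hyt hy using hex
  refine Finset.card_le_card_of_injOn y (fun i hi => by simpa using hyt i hi) ?_
  intro i hi j hj hij
  by_contra hne
  have h1 := hy i hi
  have h2 := hy j hj
  rw [← hij] at h2
  have h3 := dist_triangle_right (s i - c) (s j - c) (y i)
  rw [dist_sub_right] at h3
  linarith [hs i j hne]

/-! ### A law of large numbers for triangular arrays -/

section LLN

variable {Ω : Type*} [MeasurableSpace Ω] {μ : Measure Ω} [IsProbabilityMeasure μ]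

/-- The square expands into `G` rows of pair moments. In each row at most `N` terms need the trivial
bound `C ^ 2` and at most `G` others are below `η`; division by `G ^ 2` gives the claim. -/
lemma integral_sq_average_le {G : ℕ} {Y : Fin G → Ω → ℝ} {C η : ℝ} {N : ℕ} (hC : 0 ≤ C)
    (hη : 0 ≤ η) (hY : ∀ g, Measurable (Y g)) (hYC : ∀ g ω, |Y g ω| ≤ C)
    (hcov : ∀ g, ∃ s : Finset (Fin G), s.card ≤ N ∧
      ∀ h ∉ s, |∫ ω, Y g ω * Y h ω ∂μ| ≤ η) :
    ∫ ω, ((G : ℝ)⁻¹ * ∑ g, Y g ω) ^ 2 ∂μ ≤ N * C ^ 2 / G + η := by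
  have hint : ∀ g h, Integrable (fun ω => Y g ω * Y h ω) μ := fun g h =>
    Integrable.of_bound ((hY g).mul (hY h)).aestronglyMeasurable (C * C) (ae_of_all _ fun ω => by
      rw [norm_mul]
      exact mul_le_mul (hYC g ω) (hYC h ω) (norm_nonneg _) hC)
  have hle : ∀ g h, |∫ ω, Y g ω * Y h ω ∂μ| ≤ C ^ 2 := fun g h => by
    have := norm_integral_le_of_norm_le_const (μ := μ) (f := fun ω => Y g ω * Y h ω)
      (C := C ^ 2) (ae_of_all _ fun ω => by
        rw [norm_mul, sq]
        exact mul_le_mul (hYC g ω) (hYC h ω) (norm_nonneg _) hC)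
    simpa using this
  have e : ∀ ω, ((G : ℝ)⁻¹ * ∑ g, Y g ω) ^ 2 = (G : ℝ)⁻¹ ^ 2 * ∑ g, ∑ h, Y g ω * Y h ω := by
    intro ω
    rw [mul_pow, sq (∑ g, Y g ω), Finset.sum_mul_sum]
  have hrow : ∀ g, ∑ h, ∫ ω, Y g ω * Y h ω ∂μ ≤ N * C ^ 2 + G * η := by
    intro g
    obtain ⟨s, hs, hsη⟩ := hcov g
    classical
    rw [← Finset.sum_add_sum_compl s]
    refine add_le_add ?_ ?_
    · calc ∑ h ∈ s, ∫ ω, Y g ω * Y h ω ∂μ ≤ s.card • C ^ 2 :=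
            Finset.sum_le_card_nsmul _ _ _ fun h _ => (le_abs_self _).trans (hle g h)
        _ ≤ N * C ^ 2 := by
            rw [nsmul_eq_mul]
            exact mul_le_mul_of_nonneg_right (by exact_mod_cast hs) (sq_nonneg _)
    · calc ∑ h ∈ sᶜ, ∫ ω, Y g ω * Y h ω ∂μ ≤ sᶜ.card • η :=
            Finset.sum_le_card_nsmul _ _ _ fun h hh =>
              (le_abs_self _).trans (hsη h (Finset.mem_compl.1 hh))
        _ ≤ G * η := by
            rw [nsmul_eq_mul]
            refine mul_le_mul_of_nonneg_right ?_ hη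
            have := Finset.card_le_univ sᶜ
            rw [Fintype.card_fin] at this
            exact_mod_cast this
  simp_rw [e]
  rw [integral_const_mul, integral_finsetSum _ fun g _ => integrable_finsetSum _ fun h _ =>
    hint g h]
  simp_rw [integral_finsetSum _ fun h _ => hint _ h]
  rcases Nat.eq_zero_or_pos G with rfl | hG
  · simpa using hη
  have hG' : (0 : ℝ) < G := by exact_mod_cast hG
  calc (G : ℝ)⁻¹ ^ 2 * ∑ g, ∑ h, ∫ ω, Y g ω * Y h ω ∂μ
      ≤ (G : ℝ)⁻¹ ^ 2 * (G * (N * C ^ 2 + G * η)) := by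
        refine mul_le_mul_of_nonneg_left ?_ (by positivity)
        have := Finset.sum_le_card_nsmul Finset.univ _ _ fun g _ => hrow g
        rwa [Finset.card_univ, Fintype.card_fin, nsmul_eq_mul] at this
    _ = N * C ^ 2 / G + η := by field_simp

/-- A law of large numbers in `L¹` for triangular arrays whose members can be approximated in
`L¹`, uniformly, by uniformly bounded arrays of which every member has a non-negligible
covariance with boundedly many others only. -/
theorem tendsto_integral_abs_average_sub {X : ∀ G : ℕ, Fin G → Ω → ℝ}
    (hX : ∀ G g, Integrable (X G g) μ)
    (h : ∀ ε > 0, ∃ K : ℝ, 0 ≤ K ∧ ∃ Y : ∀ G : ℕ, Fin G → Ω → ℝ,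
      (∀ G g, Measurable (Y G g)) ∧ (∀ G g ω, |Y G g ω| ≤ K) ∧
      (∀ G g, ∫ ω, |X G g ω - Y G g ω| ∂μ ≤ ε) ∧
      ∀ η > 0, ∃ N : ℕ, ∀ (G : ℕ) (g : Fin G), ∃ s : Finset (Fin G), s.card ≤ N ∧ ∀ h ∉ s,
        |∫ ω, (Y G g ω - ∫ x, Y G g x ∂μ) * (Y G h ω - ∫ x, Y G h x ∂μ) ∂μ| ≤ η) :
    Tendsto (fun G : ℕ => ∫ ω, |(G : ℝ)⁻¹ * ∑ g, (X G g ω - ∫ x, X G g x ∂μ)| ∂μ)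
      atTop (𝓝 0) := by
  rw [Metric.tendsto_atTop]
  intro ε hε
  -- Error budget: the centred average `W` of the approximations has second moment at most `ε ^ 2 /
  -- 8`, so it contributes at most `ε / 8 + ε / 4`. The approximation errors and their means
  -- contribute `ε / 8` each. The total is `5 * ε / 8`.
  obtain ⟨K, hK, Y, hYm, hYK, hXY, hcov⟩ := h (ε / 8) (by positivity)
  obtain ⟨N, hN⟩ := hcov (ε ^ 2 / 16) (by positivity)
  obtain ⟨G₀, hG₀⟩ := exists_nat_gt (N * (2 * K) ^ 2 / (ε ^ 2 / 16))
  refine ⟨max G₀ 1, fun G hG => ?_⟩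
  have hG1 : (0 : ℝ) < G := by
    have : 1 ≤ G := (le_max_right _ _).trans hG
    exact_mod_cast this
  have hGG : (G₀ : ℝ) ≤ G := by exact_mod_cast (le_max_left _ _).trans hG
  have hYi : ∀ g, Integrable (Y G g) μ := fun g =>
    Integrable.of_bound (hYm G g).aestronglyMeasurable K (ae_of_all _ (hYK G g))
  have hYE : ∀ g, |∫ x, Y G g x ∂μ| ≤ K := fun g => by
    simpa using norm_integral_le_of_norm_le_const (μ := μ) (f := Y G g) (ae_of_all _ (hYK G g))
  have hsq := integral_sq_average_le (μ := μ) (Y := fun g ω => Y G g ω - ∫ x, Y G g x ∂μ)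
    (C := 2 * K) (by positivity) (by positivity) (fun g => (hYm G g).sub_const _)
    (fun g ω => by
      have := abs_sub (Y G g ω) (∫ x, Y G g x ∂μ)
      linarith [hYK G g ω, hYE g]) (hN G)
  have hNG : N * (2 * K) ^ 2 / G ≤ ε ^ 2 / 16 := by
    rw [div_lt_iff₀ (by positivity)] at hG₀
    rw [div_le_iff₀ hG1]
    nlinarith [sq_nonneg ε]
  set W : Ω → ℝ := fun ω => (G : ℝ)⁻¹ * ∑ g, (Y G g ω - ∫ x, Y G g x ∂μ) with hW
  set D : Fin G → Ω → ℝ := fun g ω => X G g ω - Y G g ω with hD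
  have hDi : ∀ g, Integrable (D g) μ := fun g => (hX G g).sub (hYi g)
  have hWm : Measurable W :=
    (Finset.measurable_sum _ fun g _ => (hYm G g).sub_const _).const_mul _
  have hWi : Integrable (fun ω => W ω ^ 2) μ := by
    refine Integrable.of_bound (hWm.pow_const 2).aestronglyMeasurable ((2 * K) ^ 2)
      (ae_of_all _ fun ω => ?_)
    rw [norm_pow]
    refine pow_le_pow_left₀ (norm_nonneg _) ?_ 2
    rw [hW, norm_mul, norm_inv, RCLike.norm_natCast, inv_mul_le_iff₀ hG1]
    have : ∀ g ∈ Finset.univ, ‖Y G g ω - ∫ x, Y G g x ∂μ‖ ≤ 2 * K := fun g _ => by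
      have := abs_sub (Y G g ω) (∫ x, Y G g x ∂μ)
      rw [Real.norm_eq_abs]
      linarith [hYK G g ω, hYE g]
    simpa using norm_sum_le_of_le _ this
  -- The inequality `|W| ≤ W ^ 2 / ε + ε / 4` between arithmetic and geometric means turns the
  -- second-moment bound into an `L¹` bound without square roots.
  have hpt : ∀ ω, |(G : ℝ)⁻¹ * ∑ g, (X G g ω - ∫ x, X G g x ∂μ)|
      ≤ (W ω ^ 2 / ε + ε / 4) + ((G : ℝ)⁻¹ * ∑ g, (|D g ω| + ε / 8)) := by
    intro ω
    have e1 : (G : ℝ)⁻¹ * ∑ g, (X G g ω - ∫ x, X G g x ∂μ)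
        = W ω + (G : ℝ)⁻¹ * ∑ g, (D g ω - ∫ x, D g x ∂μ) := by
      rw [hW, ← mul_add, ← Finset.sum_add_distrib]
      congr 1
      refine Finset.sum_congr rfl fun g _ => ?_
      rw [hD]
      simp only
      rw [integral_sub (hX G g) (hYi g)]
      ring
    rw [e1]
    refine (abs_add_le _ _).trans (add_le_add ?_ ?_)
    · have : 0 ≤ (|W ω| - ε / 2) ^ 2 := sq_nonneg _
      have h2 : |W ω| ^ 2 = W ω ^ 2 := sq_abs _
      have h3 : |W ω| * ε ≤ W ω ^ 2 + ε / 4 * ε := by nlinarith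
      have : W ω ^ 2 / ε + ε / 4 = (W ω ^ 2 + ε / 4 * ε) / ε := by field_simp
      rw [this, le_div_iff₀ hε]
      exact h3
    · rw [abs_mul, abs_of_nonneg (by positivity : (0 : ℝ) ≤ (G : ℝ)⁻¹)]
      refine mul_le_mul_of_nonneg_left ?_ (by positivity)
      refine (Finset.abs_sum_le_sum_abs _ _).trans (Finset.sum_le_sum fun g _ => ?_)
      refine (abs_sub _ _).trans (add_le_add le_rfl ?_)
      exact abs_integral_le_integral_abs.trans (hXY G g)
  have hDsum : Integrable (fun ω => ∑ g, (|D g ω| + ε / 8)) μ :=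
    integrable_finsetSum _ fun g _ => (hDi g).abs.add (integrable_const _)
  have hI1 : Integrable (fun ω => W ω ^ 2 / ε + ε / 4) μ :=
    (hWi.div_const _).add (integrable_const _)
  have hle := integral_mono_of_nonneg (ae_of_all _ fun _ => abs_nonneg _)
    (hI1.add (hDsum.const_mul _)) (ae_of_all μ hpt)
  rw [Pi.add_def, integral_add hI1 (hDsum.const_mul _),
    integral_add (hWi.div_const _) (integrable_const _),
    integral_div, integral_const_mul] at hle
  have hsum : ∫ ω, ∑ g, (|D g ω| + ε / 8) ∂μ = ∑ g, ∫ ω, (|D g ω| + ε / 8) ∂μ :=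
    integral_finsetSum _ fun g _ => (hDi g).abs.add (integrable_const _)
  rw [hsum] at hle
  have hd : (G : ℝ)⁻¹ * ∑ g, ∫ ω, (|D g ω| + ε / 8) ∂μ ≤ ε / 4 := by
    rw [inv_mul_le_iff₀ hG1]
    have : ∀ g ∈ Finset.univ, ∫ ω, (|D g ω| + ε / 8) ∂μ ≤ ε / 4 := fun g _ => by
      rw [integral_add (hDi g).abs (integrable_const _)]
      have := hXY G g
      simp only [integral_const, probReal_univ, smul_eq_mul, one_mul]
      linarith
    simpa using Finset.sum_le_card_nsmul _ _ _ this
  have hw : (∫ ω, W ω ^ 2 ∂μ) / ε ≤ ε / 8 := by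
    rw [div_le_iff₀ hε]
    nlinarith
  simp only [integral_const, probReal_univ, smul_eq_mul, one_mul] at hle
  rw [Real.dist_eq, sub_zero, abs_of_nonneg (integral_nonneg fun _ => abs_nonneg _)]
  linarith

end LLN

/-! ### Moments -/

section Moments

variable {Ω : Type*} [MeasurableSpace Ω] {μ : Measure Ω}

lemma integrable_abs_rpow_of_lintegral_le {f : Ω → ℝ} (hf : AEStronglyMeasurable f μ) {a : ℝ}
    (ha : 0 ≤ a) {C : ℝ≥0} (h : ∫⁻ ω, ‖f ω‖ₑ ^ a ∂μ ≤ C) :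
    Integrable (fun ω => |f ω| ^ a) μ ∧ ∫ ω, |f ω| ^ a ∂μ ≤ C := by
  have e : ∀ ω, ENNReal.ofReal (|f ω| ^ a) = ‖f ω‖ₑ ^ a := fun ω => by
    rw [← ENNReal.ofReal_rpow_of_nonneg (abs_nonneg _) ha, ← Real.norm_eq_abs, ofReal_norm]
  have hm : AEStronglyMeasurable (fun ω => |f ω| ^ a) μ :=
    (hf.aemeasurable.norm.pow_const a).aestronglyMeasurable
  refine ⟨⟨hm, ?_⟩, ?_⟩
  · rw [hasFiniteIntegral_iff_ofReal (ae_of_all _ fun ω => by positivity)]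
    simp_rw [e]
    exact h.trans_lt ENNReal.coe_lt_top
  · rw [integral_eq_lintegral_of_nonneg_ae (ae_of_all _ fun ω => by positivity) hm]
    simp_rw [e]
    exact ENNReal.toReal_le_of_le_ofReal C.2 (by simpa using h)

lemma integrable_of_lintegral_enorm_rpow_le [IsFiniteMeasure μ] {f : Ω → ℝ}
    (hf : AEStronglyMeasurable f μ) {a : ℝ} (ha : 1 ≤ a) {C : ℝ≥0}
    (h : ∫⁻ ω, ‖f ω‖ₑ ^ a ∂μ ≤ C) : Integrable f μ := by
  refine ((integrable_const (1 : ℝ)).add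
    (integrable_abs_rpow_of_lintegral_le hf (by linarith) h).1).mono' hf (ae_of_all _ fun ω => ?_)
  simp only [Pi.add_apply, Real.norm_eq_abs]
  rcases le_total |f ω| 1 with h1 | h1
  · have : 0 ≤ |f ω| ^ a := by positivity
    linarith
  · linarith [Real.self_le_rpow_of_one_le h1 ha]

lemma eLpNorm_le_of_lintegral_enorm_rpow_le [IsProbabilityMeasure μ] {f : Ω → ℝ}
    (hf : AEStronglyMeasurable f μ) {b r : ℝ} (hb : 0 < b) (hbr : b ≤ r) {C : ℝ≥0∞}
    (h : ∫⁻ ω, ‖f ω‖ₑ ^ r ∂μ ≤ C) : eLpNorm f (ENNReal.ofReal b) μ ≤ C ^ (1 / r) := by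
  have hr : 0 < r := hb.trans_le hbr
  calc eLpNorm f (ENNReal.ofReal b) μ ≤ eLpNorm f (ENNReal.ofReal r) μ :=
        eLpNorm_le_eLpNorm_of_exponent_le (ENNReal.ofReal_le_ofReal hbr) hf
    _ = (∫⁻ ω, ‖f ω‖ₑ ^ r ∂μ) ^ (1 / r) := by
        rw [eLpNorm_eq_lintegral_rpow_enorm_toReal (by simpa using hr) ENNReal.ofReal_ne_top,
          ENNReal.toReal_ofReal hr.le]
    _ ≤ C ^ (1 / r) := ENNReal.rpow_le_rpow h (by positivity)

instance : ENNReal.HolderTriple 4 4 2 where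
  inv_add_inv_eq_inv := by
    rw [show (4 : ℝ≥0∞) = 2 * 2 by norm_num, ENNReal.mul_inv (by simp) (by simp), ← two_mul,
      ← mul_assoc, ENNReal.mul_inv_cancel (by simp) (by simp), one_mul]

/-- Hölder with exponents 2, 2 and then 4, 4; on a probability space the `L²` norm of the first
factor is at most its `L⁴` norm. -/
lemma eLpNorm_mul_mul_le_of_four [IsProbabilityMeasure μ] {f g h : Ω → ℝ}
    (hf : AEStronglyMeasurable f μ) (hg : AEStronglyMeasurable g μ)
    (hh : AEStronglyMeasurable h μ) :
    eLpNorm (f * (g * h)) 1 μ ≤ eLpNorm f 4 μ * (eLpNorm g 4 μ * eLpNorm h 4 μ) := by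
  have h24 : (2 : ℝ≥0∞) ≤ 4 := by norm_num
  have h1 : eLpNorm (f • (g * h)) 1 μ ≤ eLpNorm f 2 μ * eLpNorm (g * h) 2 μ :=
    eLpNorm_smul_le_mul_eLpNorm (hg.mul hh) hf
  have h2 : eLpNorm (g • h) 2 μ ≤ eLpNorm g 4 μ * eLpNorm h 4 μ :=
    eLpNorm_smul_le_mul_eLpNorm hh hg
  exact h1.trans (mul_le_mul' (eLpNorm_le_eLpNorm_of_exponent_le h24 hf) h2)

/-- A quadratic form with random coefficients depends continuously in `L¹` on its argument
in `L⁴`. -/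
lemma eLpNorm_quadratic_sub_le [IsProbabilityMeasure μ] {ι : Type*} [Fintype ι]
    {r r' : Ω → ι → ℝ} {V : Ω → Matrix ι ι ℝ} {C η : ℝ≥0∞}
    (hr : ∀ i, AEStronglyMeasurable (fun ω => r ω i) μ)
    (hr' : ∀ i, AEStronglyMeasurable (fun ω => r' ω i) μ)
    (hV : ∀ i j, AEStronglyMeasurable (fun ω => V ω i j) μ)
    (hrC : ∀ i, eLpNorm (fun ω => r ω i) 4 μ ≤ C)
    (hrC' : ∀ i, eLpNorm (fun ω => r' ω i) 4 μ ≤ C)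
    (hVC : ∀ i j, eLpNorm (fun ω => V ω i j) 4 μ ≤ C)
    (hη : ∀ i, eLpNorm (fun ω => r ω i - r' ω i) 4 μ ≤ η) :
    eLpNorm (fun ω => r ω ⬝ᵥ (V ω *ᵥ r ω) - r' ω ⬝ᵥ (V ω *ᵥ r' ω)) 1 μ
      ≤ (Fintype.card ι) ^ 2 * (2 * (C ^ 2 * η)) := by
  have hterm : ∀ i j,
      eLpNorm (fun ω => r ω i * (V ω i j * r ω j) - r' ω i * (V ω i j * r' ω j)) 1 μ
        ≤ 2 * (C ^ 2 * η) := by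
    intro i j
    -- Telescoping replaces one residual at a time, so each summand has exactly one small factor.
    have e : (fun ω => r ω i * (V ω i j * r ω j) - r' ω i * (V ω i j * r' ω j))
        = (fun ω => r ω i - r' ω i) * ((fun ω => V ω i j) * fun ω => r ω j)
          + (fun ω => r' ω i) * ((fun ω => V ω i j) * fun ω => r ω j - r' ω j) := by
      ext ω
      simp only [Pi.add_apply, Pi.mul_apply]
      ring
    have h1 := eLpNorm_mul_mul_le_of_four ((hr i).sub (hr' i)) (hV i j) (hr j)
    have h2 := eLpNorm_mul_mul_le_of_four (hr' i) (hV i j) ((hr j).sub (hr' j))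
    rw [e]
    refine (eLpNorm_add_le (((hr i).sub (hr' i)).mul ((hV i j).mul (hr j)))
      ((hr' i).mul ((hV i j).mul ((hr j).sub (hr' j)))) le_rfl).trans ?_
    rw [two_mul]
    refine add_le_add (h1.trans ?_) (h2.trans ?_)
    · calc _ ≤ η * (C * C) := mul_le_mul' (hη i) (mul_le_mul' (hVC i j) (hrC j))
        _ = C ^ 2 * η := by ring
    · calc _ ≤ C * (C * η) := mul_le_mul' (hrC' i) (mul_le_mul' (hVC i j) (hη j))
        _ = C ^ 2 * η := by ring
  have hm : ∀ i j, AEStronglyMeasurable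
      (fun ω => r ω i * (V ω i j * r ω j) - r' ω i * (V ω i j * r' ω j)) μ := fun i j =>
    ((hr i).mul ((hV i j).mul (hr j))).sub ((hr' i).mul ((hV i j).mul (hr' j)))
  have e : (fun ω => r ω ⬝ᵥ (V ω *ᵥ r ω) - r' ω ⬝ᵥ (V ω *ᵥ r' ω))
      = ∑ x : ι × ι, fun ω => r ω x.1 * (V ω x.1 x.2 * r ω x.2)
          - r' ω x.1 * (V ω x.1 x.2 * r' ω x.2) := by
    ext ω
    simp only [dotProduct, Matrix.mulVec, Finset.mul_sum, Finset.sum_apply,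
      Finset.sum_sub_distrib, Fintype.sum_prod_type]
  rw [e]
  refine (eLpNorm_sum_le (fun x _ => hm x.1 x.2) le_rfl).trans ?_
  refine (Finset.sum_le_card_nsmul _ _ _ fun x _ => hterm x.1 x.2).trans (le_of_eq ?_)
  simp [sq]

end Moments

/-! ### Measurability of quadratic forms and matrix inverses -/

lemma Measurable.dotProduct_mulVec {Ω ι : Type*} {m : MeasurableSpace Ω} [Fintype ι]
    {r : Ω → ι → ℝ} {V : Ω → Matrix ι ι ℝ} (hr : ∀ i, Measurable fun ω => r ω i)
    (hV : ∀ i j, Measurable fun ω => V ω i j) :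
    Measurable fun ω => r ω ⬝ᵥ (V ω *ᵥ r ω) :=
  Finset.measurable_sum _ fun i _ => (hr i).mul <|
    Finset.measurable_sum _ fun j _ => (hV i j).mul (hr j)

lemma measurable_matrix_det {Ω ι : Type*} {m : MeasurableSpace Ω} [Fintype ι] [DecidableEq ι]
    {A : Ω → Matrix ι ι ℝ} (hA : ∀ i j, Measurable fun ω => A ω i j) :
    Measurable fun ω => (A ω).det := by
  simp_rw [Matrix.det_apply']
  exact Finset.measurable_sum _ fun σ _ =>
    (Finset.measurable_prod _ fun i _ => hA _ _).const_mul _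

/-- By Cramer's rule an entry of the inverse is a quotient of determinants; the inverse is zero
where the determinant vanishes, so invertibility is not needed. -/
lemma measurable_matrix_inv {Ω ι : Type*} {m : MeasurableSpace Ω} [Fintype ι] [DecidableEq ι]
    {A : Ω → Matrix ι ι ℝ} (hA : ∀ i j, Measurable fun ω => A ω i j) (i j : ι) :
    Measurable fun ω => (A ω)⁻¹ i j := by
  simp only [Matrix.inv_def, Ring.inverse_eq_inv', Matrix.smul_apply, smul_eq_mul,
    Matrix.adjugate_apply]
  refine (measurable_matrix_det hA).inv.mul (measurable_matrix_det fun k l => ?_)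
  by_cases h : k = j
  · subst h
    simp only [Matrix.updateRow_self]
    exact measurable_const
  · simp only [Matrix.updateRow_ne h]
    exact hA k l

/-! ### Scaling constants -/

namespace GEE

namespace Scaling

variable {L : ℕ} (c : Scaling L)

lemma δ_le_M (G : ℕ) (g : Fin G) (l : Fin L) : c.δ G (g, l) ≤ c.M G :=
  ((le_ciSup (f := fun l => c.δ G (g, l)) (Set.finite_range _).bddAbove l).trans
    (le_max_left _ _)).trans
    (le_ciSup (f := fun g => max (c.dg G g) (c.cmax G g)) (Set.finite_range _).bddAbove g)

lemma cq_le_M (G : ℕ) (g : Fin G) : c.cq G g ≤ c.M G :=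
  (((le_max_left _ _).trans (le_max_left _ _)).trans (le_max_right _ _)).trans
    (le_ciSup (f := fun g => max (c.dg G g) (c.cmax G g)) (Set.finite_range _).bddAbove g)

variable {c}

lemma IsAdmissible.M_pos (hc : c.IsAdmissible) {G : ℕ} (g : Fin G) : 0 < c.M G :=
  (hc.cq_pos G g).trans_le (c.cq_le_M G g)

/-- This includes `G = 0`, where the supremum over no groups is zero. -/
lemma IsAdmissible.M_nonneg (hc : c.IsAdmissible) (G : ℕ) : 0 ≤ c.M G :=
  Real.iSup_nonneg fun g =>
    ((hc.cq_pos G g).le.trans ((le_max_left _ _).trans (le_max_left _ _))).trans (le_max_right _ _)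

end Scaling

/-! ### Local statistics of the mixing input field -/

namespace Sample

variable {Ω : Type*} [mΩ : MeasurableSpace Ω] {𝓔 : Type*} [MeasurableSpace 𝓔] {d L k : ℕ}
  (S : Sample Ω 𝓔 d L k)

lemma sigma_le (G : ℕ) (U : Set (Fin G × Fin L)) : S.sigma G U ≤ mΩ :=
  iSup₂_le fun i _ => ((S.measurable_x G i).prodMk (S.measurable_innov G i)).comap_le

lemma sigma_mono {G : ℕ} {U V : Set (Fin G × Fin L)} (h : U ⊆ V) : S.sigma G U ≤ S.sigma G V :=
  biSup_mono h

lemma measurable_xg_sigma {G : ℕ} {g : Fin G} {U : Set (Fin G × Fin L)}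
    (h : ∀ l, (g, l) ∈ U) : Measurable[S.sigma G U] (S.xg G g) := by
  refine @measurable_pi_lambda _ _ _ (S.sigma G U) _ _ fun l => ?_
  have h1 : Measurable[S.sigma G U] (S.input G (g, l)) :=
    (comap_measurable _).mono (le_iSup₂_of_le (g, l) (h l) le_rfl) le_rfl
  exact measurable_fst.comp h1

lemma measurable_xg (G : ℕ) (g : Fin G) : Measurable (S.xg G g) :=
  measurable_pi_lambda _ fun l => S.measurable_x G (g, l)

/-- The sites within distance `s` of group `g`. -/
noncomputable def nearSites (G : ℕ) (g : Fin G) (s : ℕ) : Finset (Fin G × Fin L) :=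
  Finset.univ.filter fun j => ∃ l, dist (S.site G (g, l)) (S.site G j) ≤ s

lemma mem_nearSites {G : ℕ} {g : Fin G} {s : ℕ} {j : Fin G × Fin L} :
    j ∈ S.nearSites G g s ↔ ∃ l, dist (S.site G (g, l)) (S.site G j) ≤ s := by
  simp [nearSites]

variable {S}

/-- On a lattice, boundedly many sites lie within a given distance of a group. -/
lemma OnLattice.exists_card_nearSites_le (h : S.OnLattice) (s : ℕ) :
    ∃ N : ℕ, ∀ G g, (S.nearSites G g s).card ≤ N := by
  obtain ⟨-, D, -, -, ⟨ρ, hρ, hsep⟩, hD⟩ := h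
  obtain ⟨N, hN⟩ := exists_card_le_of_separated (E := Fin d → ℝ) hρ s
  refine ⟨L * N, fun G g => ?_⟩
  classical
  have hsub : S.nearSites G g s ⊆ Finset.univ.biUnion fun l : Fin L =>
      Finset.univ.filter fun j => dist (S.site G (g, l)) (S.site G j) ≤ s := by
    intro j hj
    simpa using S.mem_nearSites.1 hj
  refine (Finset.card_le_card hsub).trans ?_
  refine (Finset.card_biUnion_le_card_mul _ _ N fun l _ => ?_).trans (by simp)
  refine hN (S.site G) (fun i j hij => hsep _ ((hD G).2 i) _ ((hD G).2 j) ((hD G).1.ne hij))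
    (S.site G (g, l)) _ fun i hi => ?_
  simpa using hi

lemma alphaCoeff_le_mixing (μ : Measure Ω) [IsProbabilityMeasure μ] {u v r G : ℕ}
    {U V : Finset (Fin G × Fin L)} (hU : U.card ≤ u) (hV : V.card ≤ v)
    (hUV : ∀ i ∈ U, ∀ j ∈ V, (r : ℝ) ≤ dist (S.site G i) (S.site G j)) :
    alphaCoeff μ (S.sigma G U) (S.sigma G V) ≤ S.mixing μ u v r :=
  le_csSup ⟨1, by rintro _ ⟨G, U, V, -, -, -, rfl⟩; exact alphaCoeff_le_one μ _ _⟩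
    ⟨G, U, V, hU, hV, hUV, rfl⟩

/-- Uniformly bounded group statistics that depend on the input field within a fixed distance
have, up to boundedly many exceptions per group, negligible covariances. -/
theorem exists_card_le_covariance_le {μ : Measure Ω} [IsProbabilityMeasure μ] {τ : ℝ}
    (hlattice : S.OnLattice) (hmix : S.IsMixing μ τ) (s : ℕ)
    {Y : ∀ G : ℕ, Fin G → Ω → ℝ} {K : ℝ} (hK : 0 ≤ K)
    (hY : ∀ G g, Measurable[S.sigma G (S.nearSites G g s)] (Y G g))
    (hYK : ∀ G g ω, |Y G g ω| ≤ K) {η : ℝ} (hη : 0 < η) :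
    ∃ N : ℕ, ∀ (G : ℕ) (g : Fin G), ∃ F : Finset (Fin G), F.card ≤ N ∧ ∀ h ∉ F,
      |∫ ω, (Y G g ω - ∫ x, Y G g x ∂μ) * (Y G h ω - ∫ x, Y G h x ∂μ) ∂μ| ≤ η := by
  obtain ⟨αhat, hα, hα0, -⟩ := hmix
  obtain ⟨u, hu⟩ := hlattice.exists_card_nearSites_le s
  have hlim : Tendsto (fun r => 4 * K ^ 2 * (((u : ℝ) + u) ^ τ * αhat r)) atTop (𝓝 0) := by
    simpa using (hα0.const_mul (((u : ℝ) + u) ^ τ)).const_mul (4 * K ^ 2)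
  -- The separation `r` makes the mixing bound for sets of at most `u` sites negligible. Groups with
  -- members more than `r + 2 * s` apart have `s`-neighbourhoods at distance at least `r`, so the
  -- exceptional groups are those meeting the `(r + 2 * s)`-neighbourhood of `g`.
  obtain ⟨r, hrη, hr⟩ := ((hlim.eventually_le_const hη).and (eventually_ge_atTop 1)).exists
  obtain ⟨N, hN⟩ := hlattice.exists_card_nearSites_le (r + 2 * s)
  classical
  refine ⟨N, fun G g => ⟨(S.nearSites G g (r + 2 * s)).image Prod.fst,
    Finset.card_image_le.trans (hN G g), fun h hh => ?_⟩⟩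
  have hdist : ∀ i ∈ S.nearSites G g s, ∀ j ∈ S.nearSites G h s,
      (r : ℝ) ≤ dist (S.site G i) (S.site G j) := by
    intro i hi j hj
    obtain ⟨l, hl⟩ := S.mem_nearSites.1 hi
    obtain ⟨l', hl'⟩ := S.mem_nearSites.1 hj
    have hfar : ((r + 2 * s : ℕ) : ℝ) < dist (S.site G (g, l)) (S.site G (h, l')) := by
      by_contra hle
      exact hh (Finset.mem_image.2
        ⟨(h, l'), S.mem_nearSites.2 ⟨l, not_lt.1 hle⟩, rfl⟩)
    push_cast at hfar
    have h1 := dist_triangle4 (S.site G (g, l)) (S.site G i) (S.site G j) (S.site G (h, l'))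
    rw [dist_comm (S.site G j)] at h1
    linarith
  calc _ ≤ 4 * K ^ 2 * alphaCoeff μ (S.sigma G (S.nearSites G g s))
          (S.sigma G (S.nearSites G h s)) :=
        abs_covariance_le_alphaCoeff μ (S.sigma_le _ _) (S.sigma_le _ _) (hY G g) (hY G h) hK
          (hYK G g) (hYK G h)
    _ ≤ 4 * K ^ 2 * (((u : ℝ) + u) ^ τ * αhat r) :=
        mul_le_mul_of_nonneg_left ((alphaCoeff_le_mixing μ (hu G g) (hu G h) hdist).trans
          (hα u u r hr)) (by positivity)
    _ ≤ η := hrη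

end Sample

/-! ### Near-epoch dependence of the group criterion and the pointwise law -/

lemma Spec.measurable_inv_W {L k p q : ℕ} (M : Spec L k p q) (G : ℕ) (g : Fin G) (θ : Vec p)
    (γ : Vec q) (i j : Fin L) : Measurable fun x => (M.W G g x θ γ)⁻¹ i j :=
  measurable_matrix_inv (M.measurable_W G g θ γ) i j

namespace Problem

variable {Ω : Type*} [mΩ : MeasurableSpace Ω] {𝓔 : Type*} [MeasurableSpace 𝓔] {d L k p q : ℕ}
  (P : Problem Ω 𝓔 d L k p q)

lemma measurable_mean (G : ℕ) (g : Fin G) (θ : Vec p) (l : Fin L) :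
    Measurable fun ω => P.mean G g ω θ l :=
  (P.measurable_m G g θ l).comp (P.measurable_xg G g)

lemma measurable_inv_weight (G : ℕ) (g : Fin G) (θ : Vec p) (γ : Vec q) (i j : Fin L) :
    Measurable fun ω => (P.weight G g ω θ γ)⁻¹ i j :=
  (P.measurable_inv_W G g θ γ i j).comp (P.measurable_xg G g)

lemma measurable_resid (G : ℕ) (g : Fin G) (θ : Vec p) (l : Fin L) :
    Measurable fun ω => P.resid G g ω θ l :=
  (P.measurable_y G (g, l)).sub (P.measurable_mean G g θ l)

lemma measurable_crit (G : ℕ) (g : Fin G) (θ : Vec p) (γ : Vec q) :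
    Measurable fun ω => P.crit G g ω θ γ :=
  Measurable.dotProduct_mulVec (P.measurable_resid G g θ)
    (P.measurable_inv_weight G g θ γ)

/-- The residual vector with the responses replaced by their conditional expectations given the
input field within distance `s`. -/
noncomputable def nearResid (μ : Measure Ω) (s G : ℕ) (g : Fin G) (ω : Ω) (θ : Vec p) :
    Fin L → ℝ :=
  fun l => (μ[P.y G (g, l) | P.nearSigma G (g, l) s]) ω - P.mean G g ω θ l

/-- The group criterion with the responses replaced by their conditional expectations given the
input field within distance `s`. -/
noncomputable def nearCrit (μ : Measure Ω) (s G : ℕ) (g : Fin G) (ω : Ω) (θ : Vec p)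
    (γ : Vec q) : ℝ :=
  P.nearResid μ s G g ω θ ⬝ᵥ ((P.weight G g ω θ γ)⁻¹ *ᵥ P.nearResid μ s G g ω θ)

lemma measurable_xg_nearSites (G : ℕ) (g : Fin G) (s : ℕ) :
    Measurable[P.sigma G (P.nearSites G g s)] (P.xg G g) :=
  P.measurable_xg_sigma fun l => P.mem_nearSites.2 ⟨l, by simp⟩

lemma measurable_nearResid (μ : Measure Ω) (s G : ℕ) (g : Fin G) (θ : Vec p) (l : Fin L) :
    Measurable[P.sigma G (P.nearSites G g s)] fun ω => P.nearResid μ s G g ω θ l := by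
  refine Measurable.sub ?_ ((P.measurable_m G g θ l).comp (P.measurable_xg_nearSites G g s))
  exact stronglyMeasurable_condExp.measurable.mono
    (P.sigma_mono fun j hj => P.mem_nearSites.2 ⟨l, hj⟩) le_rfl

lemma measurable_nearCrit (μ : Measure Ω) (s G : ℕ) (g : Fin G) (θ : Vec p) (γ : Vec q) :
    Measurable[P.sigma G (P.nearSites G g s)] fun ω => P.nearCrit μ s G g ω θ γ :=
  Measurable.dotProduct_mulVec (P.measurable_nearResid μ s G g θ)
    fun i j => (P.measurable_inv_W G g θ γ i j).comp (P.measurable_xg_nearSites G g s)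

lemma Q_sub_Qbar (c : Scaling L) (μ : Measure Ω) (G : ℕ) (ω : Ω) (θ : Vec p) (γ : Vec q) :
    P.Q c G ω θ γ - P.Qbar c μ G θ γ = (G : ℝ)⁻¹ * ∑ g,
      (P.crit G g ω θ γ / c.M G - ∫ x, P.crit G g x θ γ / c.M G ∂μ) := by
  simp_rw [integral_div, Q, Qbar, ← sub_div, ← Finset.sum_div, Finset.sum_sub_distrib, mul_inv]
  ring

variable {P} {μ : Measure Ω} [IsProbabilityMeasure μ] {Θ : Set (Vec p)} {Γ : Set (Vec q)}
  {θ : Vec p} {γ : Vec q}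

/-- The case `n = 0` of the moment bounds controls the entries at a fixed parameter, and `4 ≤ r`
lets `r`-th moments control `L⁴` norms on a probability space. -/
lemma HasMoments.exists_eLpNorm_le {r : ℝ} (hmom : P.HasMoments μ Θ Γ r) (hr : 4 ≤ r)
    (hθ : θ ∈ Θ) (hγ : γ ∈ Γ) :
    ∃ C : ℝ≥0, (∀ G i, eLpNorm (P.y G i) 4 μ ≤ C) ∧
      (∀ G g l, eLpNorm (fun ω => P.mean G g ω θ l) 4 μ ≤ C) ∧
      ∀ G g i j, eLpNorm (fun ω => (P.weight G g ω θ γ)⁻¹ i j) 4 μ ≤ C := by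
  obtain ⟨C₁, h₁⟩ := hmom.moment_y
  obtain ⟨C₂, h₂⟩ := hmom.moment_m
  obtain ⟨C₃, h₃⟩ := hmom.moment_w
  have hr0 : 0 ≤ r := by linarith
  have key : ∀ (f : Ω → ℝ), Measurable f → ∀ C₀ : ℝ≥0, C₀ ≤ C₁ + C₂ + C₃ →
      ∫⁻ ω, ‖f ω‖ₑ ^ r ∂μ ≤ C₀ →
      eLpNorm f 4 μ ≤ ((C₁ + C₂ + C₃) ^ (1 / r) : ℝ≥0) := by
    intro f hf C₀ hC₀ h
    have := eLpNorm_le_of_lintegral_enorm_rpow_le hf.aestronglyMeasurable (b := 4) (by norm_num) hr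
      (h.trans (ENNReal.coe_le_coe.2 hC₀))
    rw [← ENNReal.coe_rpow_of_nonneg _ (by positivity)] at this
    simpa using this
  refine ⟨(C₁ + C₂ + C₃) ^ (1 / r), fun G i => ?_, fun G g l => ?_, fun G g i j => ?_⟩
  · exact key _ (P.measurable_y G i) C₁ (by rw [add_assoc]; exact le_self_add) (h₁ G i)
  · refine key _ (P.measurable_mean G g θ l) C₂
      (by rw [add_right_comm]; exact le_add_self) (le_trans ?_ (h₂ 0 (by norm_num) G g l))
    refine lintegral_mono fun ω => ENNReal.rpow_le_rpow ?_ hr0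
    refine le_trans (le_of_eq ?_) (le_iSup₂ (f := fun θ (_ : θ ∈ Θ) =>
      ‖iteratedFDeriv ℝ 0 (fun t => P.mean G g ω t l) θ‖ₑ) θ hθ)
    rw [← ofReal_norm, ← ofReal_norm, norm_iteratedFDeriv_zero]
  · refine key _ (P.measurable_inv_weight G g θ γ i j) C₃
      le_add_self (le_trans ?_ (h₃ 0 (by norm_num) G g i j))
    refine lintegral_mono fun ω => ENNReal.rpow_le_rpow ?_ hr0
    refine le_trans (le_of_eq ?_) (le_iSup₂ (f := fun z (_ : z ∈ Θ ×ˢ Γ) =>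
      ‖iteratedFDeriv ℝ 0 (fun z : Vec p × Vec q => (P.weight G g ω z.1 z.2)⁻¹ i j) z‖ₑ)
        (θ, γ) ⟨hθ, hγ⟩)
    rw [← ofReal_norm, ← ofReal_norm, norm_iteratedFDeriv_zero]

/-- The group criterion, scaled by `M_G`, is near-epoch dependent in `L¹` on the input field. -/
theorem exists_eLpNorm_crit_sub_nearCrit_le {c : Scaling L} {ψ : ℕ → ℝ} {r : ℝ}
    (hned : P.IsUniformlyNED μ 4 c.δ ψ) (hmom : P.HasMoments μ Θ Γ r) (hr : 4 ≤ r)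
    (hθ : θ ∈ Θ) (hγ : γ ∈ Γ) :
    ∃ C : ℝ≥0, ∀ (s G : ℕ) (g : Fin G),
      eLpNorm (fun ω => P.crit G g ω θ γ - P.nearCrit μ s G g ω θ γ) 1 μ
        ≤ ENNReal.ofReal (c.M G * (C * ψ s)) := by
  obtain ⟨C, hy, hm, hw⟩ := hmom.exists_eLpNorm_le hr hθ hγ
  -- There are `L ^ 2` entries in the quadratic form and two telescoping terms for each. Residuals
  -- have `L⁴` norm at most `2 * C`, being a response, or its conditional expectation, minus a mean.
  refine ⟨L ^ 2 * (2 * (2 * C) ^ 2), fun s G g => ?_⟩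
  have hmeas : ∀ l, Measurable fun ω => P.mean G g ω θ l :=
    P.measurable_mean G g θ
  have hnear : ∀ l, Measurable fun ω => P.nearResid μ s G g ω θ l := fun l =>
    (P.measurable_nearResid μ s G g θ l).mono (P.sigma_le _ _) le_rfl
  have h14 : (1 : ℝ≥0∞) ≤ 4 := by norm_num
  have hCC : (C : ℝ≥0∞) ≤ (2 * C : ℝ≥0) := by
    exact_mod_cast le_mul_of_one_le_left zero_le (by norm_num)
  have hC2 : (C : ℝ≥0∞) + C = (2 * C : ℝ≥0) := by
    rw [two_mul, ENNReal.coe_add]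
  refine (eLpNorm_quadratic_sub_le (C := (2 * C : ℝ≥0)) (η := ENNReal.ofReal (c.M G * ψ s))
    (fun l => (P.measurable_resid G g θ l).aestronglyMeasurable)
    (fun l => (hnear l).aestronglyMeasurable)
    (fun i j => (P.measurable_inv_weight G g θ γ i j).aestronglyMeasurable)
    (fun l => ?_) (fun l => ?_)
    (fun i j => (hw G g i j).trans hCC) (fun l => ?_)).trans (le_of_eq ?_)
  · have e : (fun ω => P.resid G g ω θ l) = P.y G (g, l) - fun ω => P.mean G g ω θ l := rfl
    rw [e, ← hC2]
    refine (eLpNorm_sub_le (P.measurable_y G (g, l)).aestronglyMeasurable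
      (hmeas l).aestronglyMeasurable h14).trans ?_
    exact add_le_add (hy G _) (hm G g l)
  · have e : (fun ω => P.nearResid μ s G g ω θ l)
        = μ[P.y G (g, l) | P.nearSigma G (g, l) s] - fun ω => P.mean G g ω θ l := rfl
    rw [e, ← hC2]
    refine (eLpNorm_sub_le (stronglyMeasurable_condExp.mono (P.sigma_le _ _)).aestronglyMeasurable
      (hmeas l).aestronglyMeasurable h14).trans ?_
    exact add_le_add ((eLpNorm_condExp_le_eLpNorm _ h14).trans (hy G _)) (hm G g l)
  · have e : (fun ω => P.resid G g ω θ l - P.nearResid μ s G g ω θ l)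
        = P.y G (g, l) - μ[P.y G (g, l) | P.nearSigma G (g, l) s] := by
      ext ω
      simp [resid, nearResid, Sample.yg]
    rw [e]
    exact (hned.near G (g, l) s).trans (ENNReal.ofReal_le_ofReal
      (mul_le_mul_of_nonneg_right (c.δ_le_M G g l) (hned.coeff_nonneg s)))
  · have : c.M G * ((L ^ 2 * (2 * (2 * C) ^ 2) : ℝ≥0) * ψ s)
        = (L ^ 2 * (2 * (2 * C) ^ 2) : ℝ≥0) * (c.M G * ψ s) := by ring
    rw [this, ENNReal.ofReal_mul (NNReal.coe_nonneg _), ENNReal.ofReal_coe_nnreal]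
    push_cast
    rw [Fintype.card_fin]
    ring

lemma integrable_crit {c : Scaling L} {a : ℝ} (ha : 1 ≤ a) (hc : c.IsAdmissible)
    (hdom : P.IsDominated c μ Θ Γ a) (hθ : θ ∈ Θ) (hγ : γ ∈ Γ) (G : ℕ) (g : Fin G) :
    Integrable (fun ω => P.crit G g ω θ γ) μ := by
  obtain ⟨C, hC⟩ := hdom θ hθ γ hγ
  have := integrable_of_lintegral_enorm_rpow_le
    ((P.measurable_crit G g θ γ).div_const _).aestronglyMeasurable ha (hC G g).1
  refine (this.mul_const (c.cq G g)).congr (ae_of_all _ fun ω => ?_)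
  exact div_mul_cancel₀ _ (hc.cq_pos G g).ne'

/-- The pointwise law of large numbers for the criterion. -/
theorem tendsto_integral_abs_Q_sub_Qbar {c : Scaling L} {ψ : ℕ → ℝ} {τ r a : ℝ}
    (ha : 1 < a) (hr : 4 ≤ r) (hlattice : P.OnLattice) (hned : P.IsUniformlyNED μ 4 c.δ ψ)
    (hmix : P.IsMixing μ τ) (hmom : P.HasMoments μ Θ Γ r) (hc : c.IsAdmissible)
    (hdom : P.IsDominated c μ Θ Γ a) (hθ : θ ∈ Θ) (hγ : γ ∈ Γ) :
    Tendsto (fun G => ∫ ω, |P.Q c G ω θ γ - P.Qbar c μ G θ γ| ∂μ) atTop (𝓝 0) := by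
  simp_rw [Q_sub_Qbar]
  have hci := integrable_crit ha.le hc hdom hθ hγ
  refine tendsto_integral_abs_average_sub
    (X := fun G g ω => P.crit G g ω θ γ / c.M G) (fun G g => (hci G g).div_const _) ?_
  intro ε hε
  obtain ⟨C, hC⟩ := exists_eLpNorm_crit_sub_nearCrit_le hned hmom hr hθ hγ
  obtain ⟨C', hC'⟩ := hdom θ hθ γ hγ
  have hs : Tendsto (fun s => C * ψ s) atTop (𝓝 0) := by
    simpa using hned.coeff_tendsto.const_mul (C : ℝ)
  obtain ⟨s, hsε⟩ := (hs.eventually_le_const (half_pos hε)).exists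
  have hKlim : Tendsto (fun K : ℝ => K ^ (1 - a) * C') atTop (𝓝 0) := by
    have := (tendsto_rpow_neg_atTop (by linarith : 0 < a - 1)).mul_const (C' : ℝ)
    simpa using this
  obtain ⟨K, hKε, hK⟩ :=
    ((hKlim.eventually_le_const (half_pos hε)).and (eventually_gt_atTop 0)).exists
  have hYm : ∀ G g, Measurable[P.sigma G (P.nearSites G g s)]
      fun ω => truncateAt K (P.nearCrit μ s G g ω θ γ / c.M G) := fun G g =>
    (measurable_truncateAt K).comp ((P.measurable_nearCrit μ s G g θ γ).div_const _)
  have hYK : ∀ G g ω, |truncateAt K (P.nearCrit μ s G g ω θ γ / c.M G)| ≤ K :=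
    fun G g ω => abs_truncateAt_le hK.le _
  refine ⟨K, hK.le, fun G g ω => truncateAt K (P.nearCrit μ s G g ω θ γ / c.M G),
    fun G g => (hYm G g).mono (P.sigma_le _ _) le_rfl, hYK, fun G g => ?_, fun η hη =>
    Sample.exists_card_le_covariance_le hlattice hmix s hK.le hYm hYK hη⟩
  have hM := hc.M_pos g
  obtain ⟨hai, haC⟩ := integrable_abs_rpow_of_lintegral_le
    ((P.measurable_crit G g θ γ).div_const _).aestronglyMeasurable (by linarith) (hC' G g).1
  have hdm : AEStronglyMeasurable
      (fun ω => P.crit G g ω θ γ - P.nearCrit μ s G g ω θ γ) μ :=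
    ((P.measurable_crit G g θ γ).sub
      ((P.measurable_nearCrit μ s G g θ γ).mono (P.sigma_le _ _) le_rfl)).aestronglyMeasurable
  have hdi : Integrable (fun ω => P.crit G g ω θ γ - P.nearCrit μ s G g ω θ γ) μ :=
    memLp_one_iff_integrable.1 ⟨hdm, (hC s G g).trans_lt ENNReal.ofReal_lt_top⟩
  have hdle : ∫ ω, |P.crit G g ω θ γ - P.nearCrit μ s G g ω θ γ| ∂μ ≤ c.M G * (C * ψ s) := by
    have h1 := hC s G g
    rw [eLpNorm_one_eq_lintegral_enorm] at h1
    have h2 := integral_norm_eq_lintegral_enorm hdm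
    simp only [Real.norm_eq_abs] at h2
    rw [h2]
    refine ENNReal.toReal_le_of_le_ofReal ?_ h1
    exact mul_nonneg hM.le (mul_nonneg C.2 (hned.coeff_nonneg s))
  -- The truncation of the criterion itself is inserted as an intermediate term. Its tail is
  -- controlled by the assumed moment, since `c_{g,q} ≤ M_G`, and truncation is 1-Lipschitz, so no
  -- moment of order `a` of `nearCrit` is needed.
  have hpt : ∀ ω, |P.crit G g ω θ γ / c.M G - truncateAt K (P.nearCrit μ s G g ω θ γ / c.M G)|
      ≤ K ^ (1 - a) * |P.crit G g ω θ γ / c.cq G g| ^ a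
        + |P.crit G g ω θ γ - P.nearCrit μ s G g ω θ γ| / c.M G := by
    intro ω
    refine (abs_sub_le _ (truncateAt K (P.crit G g ω θ γ / c.M G)) _).trans (add_le_add ?_ ?_)
    · refine (abs_sub_truncateAt_le hK ha.le _).trans
        (mul_le_mul_of_nonneg_left ?_ (by positivity))
      refine Real.rpow_le_rpow (abs_nonneg _) ?_ (by linarith)
      rw [abs_div, abs_div, abs_of_pos hM, abs_of_pos (hc.cq_pos G g)]
      exact div_le_div_of_nonneg_left (abs_nonneg _) (hc.cq_pos G g) (c.cq_le_M G g)
    · refine (abs_truncateAt_sub_truncateAt_le _ _ _).trans (le_of_eq ?_)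
      rw [← sub_div, abs_div, abs_of_pos hM]
  have hle := integral_mono_of_nonneg (ae_of_all _ fun _ => abs_nonneg _)
    ((hai.const_mul _).add (hdi.abs.div_const _)) (ae_of_all μ hpt)
  rw [Pi.add_def, integral_add (hai.const_mul _) (hdi.abs.div_const _), integral_const_mul,
    integral_div] at hle
  have h1 : K ^ (1 - a) * ∫ ω, |P.crit G g ω θ γ / c.cq G g| ^ a ∂μ ≤ ε / 2 :=
    (mul_le_mul_of_nonneg_left haC (by positivity)).trans hKε
  have h2 : (∫ ω, |P.crit G g ω θ γ - P.nearCrit μ s G g ω θ γ| ∂μ) / c.M G ≤ ε / 2 := by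
    rw [div_le_iff₀ hM]
    exact hdle.trans (by nlinarith)
  linarith

end Problem

end GEE

/-! ### Uniform law and consistency -/

namespace GEE.Problem

variable {Ω : Type*} [MeasurableSpace Ω] {𝓔 : Type*} [MeasurableSpace 𝓔] {d L k p q : ℕ}
  {P : Problem Ω 𝓔 d L k p q} {c : Scaling L} {μ : Measure Ω} {Θ : Set (Vec p)} {Γ : Set (Vec q)}

/-- The normalised criterion and its expectation inherit the Lipschitz property, with Lipschitz
constants of bounded expectation. -/
lemma IsLipschitz.exists_average (hlip : P.IsLipschitz c μ Θ Γ) (hM : ∀ G, 0 ≤ c.M G)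
    (hci : ∀ θ ∈ Θ, ∀ γ ∈ Γ, ∀ G g, Integrable (fun ω => P.crit G g ω θ γ) μ) :
    ∃ (b : ℕ → Ω → ℝ) (K : ℝ), 0 < K ∧ (∀ G, Integrable (b G) μ) ∧ (∀ G ω, 0 ≤ b G ω) ∧
      (∀ᶠ G in atTop, ∫ ω, b G ω ∂μ ≤ K) ∧
      ∀ G, ∀ θ ∈ Θ, ∀ γ ∈ Γ, ∀ θ' ∈ Θ, ∀ γ' ∈ Γ,
        (∀ ω, |P.Q c G ω θ γ - P.Q c G ω θ' γ'| ≤ b G ω * (‖θ - θ'‖ + ‖γ - γ'‖)) ∧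
        |P.Qbar c μ G θ γ - P.Qbar c μ G θ' γ'|
          ≤ (∫ ω, b G ω ∂μ) * (‖θ - θ'‖ + ‖γ - γ'‖) := by
  obtain ⟨B, hBi, hB0, hB, K, hK⟩ := hlip
  have hn : ∀ G : ℕ, 0 ≤ (c.M G * G)⁻¹ := fun G =>
    inv_nonneg.2 (mul_nonneg (hM G) (Nat.cast_nonneg G))
  have hbE : ∀ G, ∫ ω, (c.M G * G)⁻¹ * ∑ g, B G g ω ∂μ
      = (c.M G * G)⁻¹ * ∑ g, ∫ ω, B G g ω ∂μ := fun G => by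
    rw [integral_const_mul, integral_finsetSum _ fun g _ => hBi G g]
  -- The maximum with 1 makes the bound positive, so that it can serve as a divisor in covering
  -- radii.
  refine ⟨fun G ω => (c.M G * G)⁻¹ * ∑ g, B G g ω, max K 1, by positivity,
    fun G => (integrable_finsetSum _ fun g _ => hBi G g).const_mul _,
    fun G ω => mul_nonneg (hn G) (Finset.sum_nonneg fun g _ => hB0 G g ω), ?_, ?_⟩
  · filter_upwards [hK] with G hG
    rw [hbE]
    exact hG.trans (le_max_left _ _)
  · intro G θ hθ γ hγ θ' hθ' γ' hγ'
    refine ⟨fun ω => ?_, ?_⟩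
    · rw [Q, Q, ← mul_sub, abs_mul, abs_of_nonneg (hn G), mul_assoc, ← Finset.sum_sub_distrib,
        Finset.sum_mul]
      exact mul_le_mul_of_nonneg_left ((Finset.abs_sum_le_sum_abs _ _).trans
        (Finset.sum_le_sum fun g _ => hB G g ω θ hθ γ hγ θ' hθ' γ' hγ')) (hn G)
    · rw [hbE, Qbar, Qbar, ← mul_sub, abs_mul, abs_of_nonneg (hn G), mul_assoc,
        ← Finset.sum_sub_distrib, Finset.sum_mul]
      refine mul_le_mul_of_nonneg_left ((Finset.abs_sum_le_sum_abs _ _).trans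
        (Finset.sum_le_sum fun g _ => ?_)) (hn G)
      rw [← integral_sub (hci θ hθ γ hγ G g) (hci θ' hθ' γ' hγ' G g), ← integral_mul_const]
      refine abs_integral_le_integral_abs.trans (integral_mono_of_nonneg
        (ae_of_all _ fun _ => abs_nonneg _) ((hBi G g).mul_const _) (ae_of_all _ fun ω => ?_))
      exact hB G g ω θ hθ γ hγ θ' hθ' γ' hγ'

/-- The uniform law of large numbers for the criterion. -/
theorem IsLipschitz.eventually_exists_dominating [IsProbabilityMeasure μ]
    (hlip : P.IsLipschitz c μ Θ Γ) (hM : ∀ G, 0 ≤ c.M G)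
    (hci : ∀ θ ∈ Θ, ∀ γ ∈ Γ, ∀ G g, Integrable (fun ω => P.crit G g ω θ γ) μ)
    (hcompact : IsCompact (Θ ×ˢ Γ))
    (hlln : ∀ θ ∈ Θ, ∀ γ ∈ Γ,
      Tendsto (fun G => ∫ ω, |P.Q c G ω θ γ - P.Qbar c μ G θ γ| ∂μ) atTop (𝓝 0))
    {ε : ℝ} (hε : 0 < ε) :
    ∀ᶠ G in atTop, ∃ T : Ω → ℝ, Integrable T μ ∧ (∀ ω, 0 ≤ T ω) ∧ ∫ ω, T ω ∂μ ≤ ε ∧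
      ∀ ω, ∀ θ ∈ Θ, ∀ γ ∈ Γ, |P.Q c G ω θ γ - P.Qbar c μ G θ γ| ≤ T ω := by
  obtain ⟨b, K, hK, hbi, hb0, hbK, hbL⟩ := hlip.exists_average hM hci
  -- In a ball of radius `η` of the product metric the sum of the two norms is below `2 * η`. The
  -- criterion and its expectation both move, at expected cost at most `2 * η * (K + K) = ε / 2`;
  -- the errors at the centres account for the other half.
  obtain ⟨η, hη, hηε⟩ : ∃ η > 0, 4 * η * K = ε / 2 :=
    ⟨ε / (8 * K), by positivity, by field_simp; norm_num⟩
  obtain ⟨t, htsub, htfin, hcov⟩ := hcompact.finite_cover_balls hη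
  have hDi : ∀ z ∈ Θ ×ˢ Γ, ∀ G,
      Integrable (fun ω => |P.Q c G ω z.1 z.2 - P.Qbar c μ G z.1 z.2|) μ := fun z hz G =>
    (((integrable_finsetSum _ fun g _ => hci z.1 hz.1 z.2 hz.2 G g).const_mul _).sub
      (integrable_const _)).abs
  have hsum : Tendsto (fun G => ∑ z ∈ htfin.toFinset,
      ∫ ω, |P.Q c G ω z.1 z.2 - P.Qbar c μ G z.1 z.2| ∂μ) atTop (𝓝 0) := by
    rw [← Finset.sum_const_zero (s := htfin.toFinset)]
    refine tendsto_finsetSum _ fun z hz => ?_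
    have hz' := htsub (htfin.mem_toFinset.1 hz)
    exact hlln z.1 hz'.1 z.2 hz'.2
  have hsmall : ∀ᶠ G in atTop, ∑ z ∈ htfin.toFinset,
      ∫ ω, |P.Q c G ω z.1 z.2 - P.Qbar c μ G z.1 z.2| ∂μ ≤ ε / 2 :=
    hsum.eventually_le_const (half_pos hε)
  filter_upwards [hbK, hsmall] with G hG hG'
  have hSi : Integrable (fun ω => ∑ z ∈ htfin.toFinset,
      |P.Q c G ω z.1 z.2 - P.Qbar c μ G z.1 z.2|) μ :=
    integrable_finsetSum _ fun z hz => hDi z (htsub (htfin.mem_toFinset.1 hz)) G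
  have hE0 : 0 ≤ ∫ ω, b G ω ∂μ := integral_nonneg (hb0 G)
  have hSE : ∫ ω, ∑ z ∈ htfin.toFinset, |P.Q c G ω z.1 z.2 - P.Qbar c μ G z.1 z.2| ∂μ
      = ∑ z ∈ htfin.toFinset, ∫ ω, |P.Q c G ω z.1 z.2 - P.Qbar c μ G z.1 z.2| ∂μ :=
    integral_finsetSum _ fun z hz => hDi z (htsub (htfin.mem_toFinset.1 hz)) G
  have hRi : Integrable (fun ω => 2 * η * (b G ω + ∫ x, b G x ∂μ)) μ :=
    ((hbi G).add (integrable_const _)).const_mul _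
  -- A sum over the centres, in place of a supremum over the parameter space, gives an explicitly
  -- integrable dominating function.
  refine ⟨fun ω => ∑ z ∈ htfin.toFinset, |P.Q c G ω z.1 z.2 - P.Qbar c μ G z.1 z.2|
    + 2 * η * (b G ω + ∫ x, b G x ∂μ), hSi.add hRi, fun ω => ?_, ?_, fun ω θ hθ γ hγ => ?_⟩
  · have := hb0 G ω
    exact add_nonneg (Finset.sum_nonneg fun _ _ => abs_nonneg _) (by positivity)
  · rw [integral_add hSi hRi, hSE, integral_const_mul, integral_add (hbi G) (integrable_const _)]
    simp only [integral_const, probReal_univ, smul_eq_mul, one_mul]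
    nlinarith
  · obtain ⟨z, hz, hzb⟩ := Set.mem_iUnion₂.1 (hcov (Set.mk_mem_prod hθ hγ))
    rw [Metric.mem_ball, Prod.dist_eq, max_lt_iff, dist_eq_norm, dist_eq_norm] at hzb
    obtain ⟨h1, h2⟩ := hbL G θ hθ γ hγ z.1 (htsub hz).1 z.2 (htsub hz).2
    have hd : ‖θ - z.1‖ + ‖γ - z.2‖ ≤ 2 * η := by linarith [hzb.1, hzb.2]
    have h3 := (h1 ω).trans (mul_le_mul_of_nonneg_left hd (hb0 G ω))
    have h4 := h2.trans (mul_le_mul_of_nonneg_left hd hE0)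
    have hzt : z ∈ htfin.toFinset := htfin.mem_toFinset.2 hz
    have h5 := Finset.single_le_sum
      (f := fun z : Vec p × Vec q => |P.Q c G ω z.1 z.2 - P.Qbar c μ G z.1 z.2|)
      (fun z _ => abs_nonneg (P.Q c G ω z.1 z.2 - P.Qbar c μ G z.1 z.2)) hzt
    rw [abs_le] at h3 h4 ⊢
    have h6 := abs_le.1 h5
    constructor <;> linarith

/-- Consistency of minimisers of the criterion from a uniform law of large numbers. -/
theorem tendstoInMeasure_of_isGEE [IsProbabilityMeasure μ]
    (hlip : P.IsLipschitz c μ Θ Γ) (hM : ∀ G, 0 ≤ c.M G)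
    (hci : ∀ θ ∈ Θ, ∀ γ ∈ Γ, ∀ G g, Integrable (fun ω => P.crit G g ω θ γ) μ)
    (hcompact : IsCompact (Θ ×ˢ Γ))
    (hlln : ∀ θ ∈ Θ, ∀ γ ∈ Γ,
      Tendsto (fun G => ∫ ω, |P.Q c G ω θ γ - P.Qbar c μ G θ γ| ∂μ) atTop (𝓝 0))
    {ν : Vec p → Vec p → ℝ} (hν : IsMetricOn ν Θ) {θ₀ : Vec p} {γ₀ : Vec q}
    (hθ₀ : θ₀ ∈ Θ) (hγ₀ : γ₀ ∈ Γ) (hid : P.IsIdentified c μ Θ Γ ν θ₀ γ₀)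
    {θhat : ℕ → Ω → Vec p} {γhat : ℕ → Ω → Vec q}
    (hgee : ∀ G, ∀ᵐ ω ∂μ, P.IsGEE c Θ Γ G ω (θhat G ω) (γhat G ω)) :
    TendstoInMeasure μ (fun G ω => ν (θhat G ω) θ₀) atTop (fun _ => 0) := by
  rw [tendstoInMeasure_iff_dist]
  intro ε hε
  have hΓ : IsCompact Γ := by
    have := hcompact.image continuous_snd
    rwa [Set.snd_image_prod ⟨θ₀, hθ₀⟩] at this
  obtain ⟨b, K, hK, -, -, hbK, hbL⟩ := hlip.exists_average hM hci
  choose! c₀ hc₀ hidc using hid ε hε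
  -- The gap `c₀ γ` depends on `γ`. The radius is chosen so that moving `γ` within the ball changes
  -- the expected criterion by at most a quarter of that gap; finiteness of the cover then gives a
  -- positive smallest gap.
  obtain ⟨t, htΓ, hcov⟩ := hΓ.elim_nhds_subcover (fun γ => Metric.ball γ (c₀ γ / (4 * K)))
    fun γ hγ => Metric.ball_mem_nhds γ (div_pos (hc₀ γ hγ) (by positivity))
  have hne : t.Nonempty := by
    obtain ⟨γ, hγ, -⟩ := Set.mem_iUnion₂.1 (hcov hγ₀)
    exact ⟨γ, hγ⟩
  obtain ⟨γm, hγm, hmin⟩ := t.exists_min_image c₀ hne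
  have hκ := hc₀ γm (htΓ γm hγm)
  rw [ENNReal.tendsto_nhds_zero]
  intro δ hδ
  -- The tolerance `δ` may be infinite; a smaller finite one is used for Markov's inequality.
  obtain ⟨δ', hδ'0, hδ'⟩ := ENNReal.lt_iff_exists_nnreal_btwn.1 hδ
  have hδ'pos : (0 : ℝ) < δ' := by exact_mod_cast hδ'0
  filter_upwards [hbK, (Filter.eventually_all_finset t).2 fun γ hγ => hidc γ (htΓ γ hγ),
    hlip.eventually_exists_dominating hM hci hcompact hlln
      (mul_pos (div_pos hκ (by norm_num : (0 : ℝ) < 8)) hδ'pos)] with G hbG hidG hT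
  obtain ⟨T, hTi, hT0, hTE, hTle⟩ := hT
  refine le_trans ?_ hδ'.le
  have hsub : {ω | ε ≤ dist (ν (θhat G ω) θ₀) 0} ≤ᵐ[μ] {ω | c₀ γm / 8 ≤ T ω} := by
    filter_upwards [hgee G] with ω hω hωε
    obtain ⟨hθ, hγ, hle⟩ := hω
    have hωε' : ε ≤ ν (θhat G ω) θ₀ := by
      have h : ε ≤ dist (ν (θhat G ω) θ₀) 0 := hωε
      rwa [Real.dist_0_eq_abs, abs_of_nonneg (hν.nonneg _ hθ _ hθ₀)] at h
    obtain ⟨γ, hγt, hγb⟩ := Set.mem_iUnion₂.1 (hcov hγ)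
    rw [Metric.mem_ball, dist_comm, dist_eq_norm] at hγb
    have hγΓ := htΓ γ hγt
    have h1 := hidG γ hγt _ hθ hωε'
    have h2 := (hbL G _ hθ γ hγΓ _ hθ _ hγ).2
    rw [sub_self, norm_zero, zero_add] at h2
    have h3 := h2.trans (mul_le_mul hbG hγb.le (norm_nonneg _) hK.le)
    rw [show K * (c₀ γ / (4 * K)) = c₀ γ / 4 by field_simp] at h3
    have h4 := abs_le.1 h3
    have h5 := abs_le.1 (hTle ω _ hθ _ hγ)
    have h6 := abs_le.1 (hTle ω _ hθ₀ _ hγ₀)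
    have h7 := abs_le.1 (hTle ω _ hθ₀ _ hγΓ)
    have h8 := hle _ hθ₀ _ hγ₀
    have h9 := hle _ hθ₀ _ hγΓ
    -- The estimator beats both competitors `(θ₀, γ₀)` and `(θ₀, γ)`. Passing between `Q` and `Qbar`
    -- costs one `T ω` at the estimator and one at the competitor. Against the gap this forces `2 *
    -- T ω ≥ 3 * c₀ γ / 4`, which is more than is required below.
    have h10 : P.Qbar c μ G (θhat G ω) γ - c₀ γ / 4 - 2 * T ω
        ≤ min (P.Qbar c μ G θ₀ γ₀) (P.Qbar c μ G θ₀ γ) := le_min (by linarith) (by linarith)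
    have h11 := hmin γ hγt
    show c₀ γm / 8 ≤ T ω
    linarith
  refine (measure_mono_ae hsub).trans ?_
  have hmarkov := mul_meas_ge_le_integral_of_nonneg (ae_of_all μ hT0) hTi (c₀ γm / 8)
  have hreal : μ.real {ω | c₀ γm / 8 ≤ T ω} ≤ δ' :=
    le_of_mul_le_mul_left (hmarkov.trans hTE) (div_pos hκ (by norm_num))
  rw [← ofReal_measureReal]
  exact (ENNReal.ofReal_le_ofReal hreal).trans (by simp)

end GEE.Problem

theorem theorem1 {Ω : Type*} [MeasurableSpace Ω] (μ : Measure Ω) [IsProbabilityMeasure μ]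
    {𝓔 : Type*} [MeasurableSpace 𝓔] {d L k p q : ℕ} (hL : 1 ≤ L)
    (P : GEE.Problem Ω 𝓔 d L k p q)
    (Θ : Set (GEE.Vec p)) (Γ : Set (GEE.Vec q)) (θ₀ : GEE.Vec p) (γ₀ : GEE.Vec q)
    (hθ₀ : θ₀ ∈ Θ) (hγ₀ : γ₀ ∈ Γ) (hmean : P.CorrectMean μ θ₀)
    (ν : GEE.Vec p → GEE.Vec p → ℝ) (hν : GEE.IsMetricOn ν Θ)
    (c : GEE.Scaling L) (ψ : ℕ → ℝ) (τ r a : ℝ) (hτ : 0 ≤ τ) (ha : 1 < a) (hr : 4 * a < r)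
    -- lattice with minimum spacing
    (hlattice : P.OnLattice)
    -- near-epoch dependence of the responses on a mixing input field
    (hned : P.IsUniformlyNED μ 4 c.δ ψ) (hψ : Summable fun s : ℕ => (s : ℝ) ^ (d - 1) * ψ s)
    (hmix : P.IsMixing μ τ)
    -- compact parameter space
    (hcompact : IsCompact (Θ ×ˢ Γ))
    -- Lipschitz group criteria
    (hlip : P.IsLipschitz c μ Θ Γ)
    -- smoothness, moments and scaling constants
    (hmom : P.HasMoments μ Θ Γ r) (hc : c.IsAdmissible) (hdom : P.IsDominated c μ Θ Γ a)
    -- mixing of the grouped input field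
    (hgmix : P.IsGroupMixing μ τ)
    -- identification
    (hid : P.IsIdentified c μ Θ Γ ν θ₀ γ₀)
    -- the estimator
    (θhat : ∀ G : ℕ, Ω → GEE.Vec p) (γhat : ∀ G : ℕ, Ω → GEE.Vec q)
    (hgee : ∀ G, ∀ᵐ ω ∂μ, P.IsGEE c Θ Γ G ω (θhat G ω) (γhat G ω)) :
    TendstoInMeasure μ (fun G ω => ν (θhat G ω) θ₀) atTop (fun _ => 0) := by
  have hr4 : 4 ≤ r := by linarith
  have hci : ∀ θ ∈ Θ, ∀ γ ∈ Γ, ∀ G g, Integrable (fun ω => P.crit G g ω θ γ) μ :=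
    fun θ hθ γ hγ => GEE.Problem.integrable_crit ha.le hc hdom hθ hγ
  exact GEE.Problem.tendstoInMeasure_of_isGEE hlip hc.M_nonneg hci hcompact
    (fun θ hθ γ hγ => GEE.Problem.tendsto_integral_abs_Q_sub_Qbar ha hr4 hlattice hned hmix hmom hc
      hdom hθ hγ) hν hθ₀ hγ₀ hid hgee
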